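/- Conventions. All Lie algebras are real and finite-dimensional. For a Lie algebra $\mathfrak g$, the exterior derivative $d$ on $\Lambda^*\mathfrak g^*$ is the Chevalley–Eilenberg differential with trivial coefficients, so that $(d\alpha)(X,Y)=-\alpha([X,Y])$ for $\alpha\in\mathfrak g^*$; $H^k(\mathfrak g)$ is its cohomology, $\mathrm h^k(\mathfrak g)=\dim H^k(\mathfrak g)$ and, for $\dim\mathfrak g=4$, $\mathrm h^*(\mathfrak g)=(\mathrm h^1(\mathfrak g),\dots,\mathrm h^4(\mathfrak g))$. $\mathrm{Nil}(\mathfrak g)$ is the nilradical (the largest nilpotent ideal). $\mathfrak g$ is indecomposable if it is nonzero and not the direct sum of two nonzero ideals. Let $V$ be a six-dimensional real vector space and $\rho\in\Lambda^3V^*$. For $0\neq\nu\in\Lambda^6V^*$ let $K_\rho^{\nu}\in\mathrm{End}(V)$ be defined by $K_\rho^{\nu}(v)\lrcorner\,\nu=(v\lrcorner\rho)\wedge\rho$ for $v\in V$, and let $\lambda_\nu(\rho)=\frac16\operatorname{tr}\big((K_\rho^{\nu})^2\big)\in\mathbb R$. The quartic invariant of $\rho$ is $\lambda(\rho)=\lambda_\nu(\rho)\,\nu\otimes\nu\in(\Lambda^6V^*)^{\otimes2}$,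 which does not depend on $\nu$; $\lambda(\rho)\ge0$ and $\lambda(\rho)=0$ mean that $\lambda_\nu(\rho)\geq0$, respectively $\lambda_\nu(\rho)=0$, for every $\nu\ne0$. The following Lie algebras are given by the images $(de^1,de^2,\dots)$ of a basis of the dual space under $d$, where $e^{ij}=e^i\wedge e^j$: $\mathfrak r_2$: $(0,e^{12})$; $A_{4,1}$: $(e^{24},e^{34},0,0)$; $A_{4,5}^{-1,1}$: $(e^{14},-e^{24},e^{34},0)$; $A_{4,9}^{-1/2}$: $(\tfrac12e^{14}+e^{23},e^{24},-\tfrac12e^{34},0)$; $A_{4,12}$: $(e^{13}+e^{24},e^{41}+e^{23},0,0)$. Further, $\mathbb R^n$ denotes the abelian Lie algebra of dimension $n$. Proposition. Let $\mathfrak g=\mathfrak g_4\oplus\mathfrak g_2$ be a direct sum of Lie algebras, where $\mathfrak g_4$ is four-dimensional and indecomposable, and let $\rho\in\Lambda^3\mathfrak g^*$ be closed, i.e. $d\rho=0$. (i) If $\mathfrak g_2\cong\mathbb R^2$ and $\mathfrak g_4$ is not isomorphic to any of $A_{4,1}$, $A_{4,5}^{-1,1}$, $A_{4,9}^{-1/2}$,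 $A_{4,12}$, then $\lambda(\rho)\geq0$. (ii) If $\mathfrak g_2\cong\mathfrak r_2$, $\mathrm{Nil}(\mathfrak g_4)\cong\mathbb R^3$ and $\mathrm h^*(\mathfrak g_4)=(1,0,0,0)$, then $\lambda(\rho)\geq0$. (iii) If $\mathfrak g_2\cong\mathbb R^2$ and $\mathrm h^*(\mathfrak g_4)=(1,0,0,0)$, then $\lambda(\rho)=0$. -/

import Mathlib

open Module

noncomputable section

namespace HalfFlat

/-! ### Exterior algebra of a real vector space -/

section Forms

variable {V : Type*} [AddCommGroup V] [Module ℝ V]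

/-- The wedge product `α ∧ β` of a `p`-form and a `q`-form, bilinear in `(α, β)`, in the shuffle
normalization: `(α ∧ β)(v₁, …) = ∑ sign σ • α (v_{σ 1}, …) * β (v_{σ (p+1)}, …)`, the sum running
over the `(p, q)`-shuffles `σ`. -/
def wedge (p q : ℕ) {r : ℕ} (hr : p + q = r) :
    (V [⋀^Fin p]→ₗ[ℝ] ℝ) →ₗ[ℝ] (V [⋀^Fin q]→ₗ[ℝ] ℝ) →ₗ[ℝ] (V [⋀^Fin r]→ₗ[ℝ] ℝ) where
  toFun α :=
    { toFun := fun β =>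
        ((LinearMap.mul' ℝ ℝ).compAlternatingMap (α.domCoprod β)).domDomCongr
          (finSumFinEquiv.trans (finCongr hr))
      map_add' := fun β γ => by
        rw [← AlternatingMap.domCoprod'_apply, TensorProduct.tmul_add, map_add]
        ext v; simp
      map_smul' := fun c β => by
        rw [← AlternatingMap.domCoprod'_apply, TensorProduct.tmul_smul, map_smul]
        ext v; simp }
  map_add' α α' := by
    ext β v
    simp only [LinearMap.coe_mk, AddHom.coe_mk, LinearMap.add_apply]
    rw [← AlternatingMap.domCoprod'_apply, TensorProduct.add_tmul, map_add]
    simp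
  map_smul' c α := by
    ext β v
    simp only [LinearMap.coe_mk, AddHom.coe_mk, LinearMap.smul_apply, RingHom.id_apply]
    rw [← AlternatingMap.domCoprod'_apply, ← TensorProduct.smul_tmul', map_smul]
    simp

/-- For a volume form `ν` on a six-dimensional space the contraction `X ↦ X ⌟ ν` is an isomorphism
from vectors to five-forms. -/
theorem curryLeft_bijective (hV : finrank ℝ V = 6) (ν : V [⋀^Fin 6]→ₗ[ℝ] ℝ) (hν : ν ≠ 0) :
    Function.Bijective (AlternatingMap.curryLeft ν) := by
  have : FiniteDimensional ℝ V := FiniteDimensional.of_finrank_pos (by omega)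
  have hinj : Function.Injective (AlternatingMap.curryLeft ν) := by
    rw [injective_iff_map_eq_zero]
    intro v hv
    by_contra hv0
    apply hν
    ext x
    by_cases hx : LinearIndependent ℝ x
    · let b := basisOfLinearIndependentOfCardEqFinrank hx (by simp [hV])
      have hb : ∀ i, b i = x i := fun i => by simp [b]
      obtain ⟨i, hi⟩ : ∃ i, b.repr v i ≠ 0 := by
        by_contra! h
        exact hv0 (b.repr.map_eq_zero_iff.1 (Finsupp.ext h))
      have h1 : ν (Function.update x i v) = b.repr v i * ν x := by
        conv_lhs => rw [← b.sum_repr v]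
        rw [AlternatingMap.map_update_sum, Finset.sum_eq_single i]
        · rw [AlternatingMap.map_update_smul, hb, Function.update_eq_self, smul_eq_mul]
        · intro j _ hj
          rw [AlternatingMap.map_update_smul, hb, AlternatingMap.map_update_self _ _ hj.symm,
            smul_zero]
        · simp
      have h2 : ν (Function.update x i v) = 0 := by
        have h3 : Function.update x i v = i.insertNth v (i.removeNth x) := by
          simp [Fin.insertNth_removeNth]
        rw [h3, AlternatingMap.map_insertNth, ← AlternatingMap.curryLeft_apply_apply, hv]
        simp
      rw [h2] at h1
      have := (mul_eq_zero.1 h1.symm).resolve_left hi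
      simpa using this
    · simpa using AlternatingMap.map_linearDependent ν x hx
  have e : (V [⋀^Fin 5]→ₗ[ℝ] ℝ) ≃ₗ[ℝ] Dual ℝ (⋀[ℝ]^5 V) :=
    exteriorPower.alternatingMapLinearEquiv
  have : FiniteDimensional ℝ (V [⋀^Fin 5]→ₗ[ℝ] ℝ) := e.symm.finiteDimensional
  have hdim : finrank ℝ V = finrank ℝ (V [⋀^Fin 5]→ₗ[ℝ] ℝ) := by
    rw [e.finrank_eq, Subspace.dual_finrank_eq, exteriorPower.finrank_eq, hV]
    decide
  exact ⟨hinj, (LinearMap.injective_iff_surjective_of_finrank_eq_finrank hdim).1 hinj⟩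

/-- The linear map `v ↦ (v ⌟ ρ) ∧ ρ` from vectors to five-forms. -/
def fiveForm (ρ : V [⋀^Fin 3]→ₗ[ℝ] ℝ) : V →ₗ[ℝ] (V [⋀^Fin 5]→ₗ[ℝ] ℝ) :=
  (wedge 2 3 rfl).flip ρ ∘ₗ AlternatingMap.curryLeft ρ

theorem fiveForm_apply (ρ : V [⋀^Fin 3]→ₗ[ℝ] ℝ) (v : V) :
    fiveForm ρ v = wedge 2 3 rfl (AlternatingMap.curryLeft ρ v) ρ := by
  rw [fiveForm, LinearMap.comp_apply, LinearMap.flip_apply]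

open Classical in
/-- The endomorphism `K_ρ` of a three-form `ρ` on a six-dimensional space, relative to a volume
form `ν`: `K_ρ v` is the vector with `K_ρ v ⌟ ν = (v ⌟ ρ) ∧ ρ`, so that the intrinsic
`K_ρ ∈ End V ⊗ Λ⁶V*` is `K ν ρ ⊗ ν`. (It is set to be zero if the contraction with `ν` is not
invertible.) -/
def K (ν : V [⋀^Fin 6]→ₗ[ℝ] ℝ) (ρ : V [⋀^Fin 3]→ₗ[ℝ] ℝ) : V →ₗ[ℝ] V :=
  if h : Function.Bijective (AlternatingMap.curryLeft ν) then
    (LinearEquiv.ofBijective (AlternatingMap.curryLeft ν) h).symm.toLinearMap ∘ₗ fiveForm ρ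
  else 0

theorem K_spec (hV : finrank ℝ V = 6) (ν : V [⋀^Fin 6]→ₗ[ℝ] ℝ) (hν : ν ≠ 0)
    (ρ : V [⋀^Fin 3]→ₗ[ℝ] ℝ) (v : V) :
    AlternatingMap.curryLeft ν (K ν ρ v) = fiveForm ρ v := by
  have h := curryLeft_bijective hV ν hν
  rw [K, dif_pos h]
  exact (LinearEquiv.ofBijective (AlternatingMap.curryLeft ν) h).apply_symm_apply _

/-- The quartic invariant `λ(ρ) = (1/6) tr K_ρ²` relative to the volume form `ν`: the intrinsic
`λ(ρ) ∈ (Λ⁶V*)^{⊗2}` is `quarticInvariant ν ρ • ν ⊗ ν`. -/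
def quarticInvariant (ν : V [⋀^Fin 6]→ₗ[ℝ] ℝ) (ρ : V [⋀^Fin 3]→ₗ[ℝ] ℝ) : ℝ :=
  (1 / 6) * LinearMap.trace ℝ V (K ν ρ ∘ₗ K ν ρ)

end Forms

/-! ### The Chevalley–Eilenberg complex with trivial real coefficients -/

section Lie

variable (L : Type*) [LieRing L] [LieAlgebra ℝ L]

/-- The bilinear map `(x, y) ↦ ω(⁅x, y⁆, ·, …, ·)`. -/
def bracketContraction (n : ℕ) (ω : L [⋀^Fin (n + 1)]→ₗ[ℝ] ℝ) :
    L →ₗ[ℝ] L →ₗ[ℝ] (L [⋀^Fin n]→ₗ[ℝ] ℝ) :=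
  LinearMap.mk₂ ℝ (fun x y => AlternatingMap.curryLeft ω ⁅x, y⁆)
    (fun x x' y => by rw [add_lie, map_add]) (fun c x y => by rw [smul_lie, map_smul])
    (fun x y y' => by rw [lie_add, map_add]) (fun c x y => by rw [lie_smul, map_smul])

/-- The exterior derivative `d : ΛⁿL* → Λⁿ⁺¹L*`: it is zero on `Λ⁰L*`, and on forms of positive
degree it is given by the usual formula, see `d_apply` below (`(dα)(x, y) = - α(⁅x, y⁆)` on
one-forms, see `d_one_apply`). -/
def d : (n : ℕ) → (L [⋀^Fin n]→ₗ[ℝ] ℝ) →ₗ[ℝ] (L [⋀^Fin (n + 1)]→ₗ[ℝ] ℝ)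
  | 0 => 0
  | n + 1 =>
    { toFun := fun ω => (-(1 / 2) : ℝ) • AlternatingMap.alternatizeUncurryFin
        (AlternatingMap.alternatizeUncurryFinLM ∘ₗ bracketContraction L n ω)
      map_add' := fun ω η => by
        have : bracketContraction L n (ω + η)
            = bracketContraction L n ω + bracketContraction L n η := by
          ext; simp [bracketContraction]
        rw [this, LinearMap.comp_add, AlternatingMap.alternatizeUncurryFin_add, smul_add]
      map_smul' := fun c ω => by
        have : bracketContraction L n (c • ω) = c • bracketContraction L n ω := by
          ext; simp [bracketContraction]
        rw [this, LinearMap.comp_smul, AlternatingMap.alternatizeUncurryFin_smul, smul_comm,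
          RingHom.id_apply] }

/-- `dω(v₀, …, v_{n+1}) = ∑_{a < b} (-1)^{a+b} ω(⁅v_a, v_b⁆, v₀, …, v̂_a, …, v̂_b, …, v_{n+1})`.
The pairs `a < b` are written as `a = i`, `b = j + 1` with `i ≤ j`. -/
theorem d_apply (n : ℕ) (ω : L [⋀^Fin (n + 1)]→ₗ[ℝ] ℝ) (v : Fin (n + 2) → L) :
    d L (n + 1) ω v = ∑ i : Fin (n + 1), ∑ j ≥ i, (-1 : ℝ) ^ (i + (j + 1) : ℕ) *
      ω (Matrix.vecCons ⁅v i.castSucc, v j.succ⁆ (j.removeNth (i.castSucc.removeNth v))) := by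
  change (-(1 / 2) : ℝ) • AlternatingMap.alternatizeUncurryFin
    (AlternatingMap.alternatizeUncurryFinLM ∘ₗ bracketContraction L n ω) v = _
  rw [AlternatingMap.alternatizeUncurryFin_alternatizeUncurryFinLM_comp_apply, Finset.smul_sum]
  refine Finset.sum_congr rfl fun i _ => ?_
  rw [Finset.smul_sum]
  refine Finset.sum_congr rfl fun j _ => ?_
  have h : bracketContraction L n ω (v j.succ) (v i.castSucc)
      = - bracketContraction L n ω (v i.castSucc) (v j.succ) := by
    simp only [bracketContraction, LinearMap.mk₂_apply]
    rw [← lie_skew, map_neg]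
  rw [h]
  simp only [bracketContraction, LinearMap.mk₂_apply, AlternatingMap.neg_apply,
    AlternatingMap.curryLeft_apply_apply, smul_eq_mul, zsmul_eq_mul]
  push_cast
  ring

theorem d_one_apply (α : L [⋀^Fin 1]→ₗ[ℝ] ℝ) (x y : L) :
    d L 1 α ![x, y] = - α ![⁅x, y⁆] := by
  rw [d_apply, Fin.sum_univ_one, show (Finset.Ici (0 : Fin 1)) = {0} from rfl,
    Finset.sum_singleton]
  have : Matrix.vecCons ⁅(![x, y] : Fin 2 → L) (0 : Fin 1).castSucc, (![x, y] : Fin 2 → L)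
      (0 : Fin 1).succ⁆ ((0 : Fin 1).removeNth ((0 : Fin 1).castSucc.removeNth ![x, y]))
      = ![⁅x, y⁆] := by
    ext i
    fin_cases i
    rfl
  rw [this]
  simp

/-- The cocycles in `ΛᵏL*`: the kernel of `d`. -/
def cocycles (k : ℕ) : Submodule ℝ (L [⋀^Fin k]→ₗ[ℝ] ℝ) := LinearMap.ker (d L k)

/-- The coboundaries in `ΛᵏL*`: the image of `d` from degree `k - 1` (zero for `k = 0`). -/
def coboundaries : (k : ℕ) → Submodule ℝ (L [⋀^Fin k]→ₗ[ℝ] ℝ)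
  | 0 => ⊥
  | k + 1 => LinearMap.range (d L k)

/-- The Lie algebra cohomology group `Hᵏ(L)` with trivial real coefficients: cocycles modulo
coboundaries, realized as the subspace `Zᵏ / Bᵏ` of `ΛᵏL* / Bᵏ`. -/
def cohomology (k : ℕ) : Submodule ℝ ((L [⋀^Fin k]→ₗ[ℝ] ℝ) ⧸ coboundaries L k) :=
  (cocycles L k).map (coboundaries L k).mkQ

/-- The dimension `hᵏ(L)` of `Hᵏ(L)`. -/
def h (k : ℕ) : ℕ := finrank ℝ (cohomology L k)

/-- The nilradical: the sum of all ideals that are nilpotent as Lie algebras. (Mathlib's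
`maxNilpotentIdeal` is something else: it asks the ideal to be nilpotent as an `L`-module.) -/
def nilradical : LieIdeal ℝ L := sSup {I : LieIdeal ℝ L | LieRing.IsNilpotent I}

/-- A nonzero Lie algebra is indecomposable if it is not the direct sum of two nonzero ideals. -/
def Indecomposable : Prop :=
  Nontrivial L ∧ ∀ I J : LieIdeal ℝ L, IsCompl I J → I = ⊥ ∨ J = ⊥

variable {L}

/-- The value on `(x, y)` of the two-form `eⁱʲ = eⁱ ∧ eʲ`, where `(e¹, e², …)` is the basis of `L*`
dual to the basis `b` of `L`. The indices start from zero. -/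
def e {n : ℕ} (b : Basis (Fin n) ℝ L) (i j : Fin n) (x y : L) : ℝ :=
  b.coord i x * b.coord j y - b.coord i y * b.coord j x

/-- The value on `(x, y)` of the two-form `deⁱ`, where `(e¹, e², …)` is the basis of `L*` dual to
the basis `b` of `L`. The index starts from zero. -/
def de {n : ℕ} (b : Basis (Fin n) ℝ L) (i : Fin n) (x y : L) : ℝ :=
  -b.coord i ⁅x, y⁆

variable (L)

/-- `L ≅ A_{4,1}`: `(de¹, de², de³, de⁴) = (e²⁴, e³⁴, 0, 0)`. -/
def IsA41 : Prop :=
  ∃ b : Basis (Fin 4) ℝ L, ∀ x y : L,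
    de b 0 x y = e b 1 3 x y ∧ de b 1 x y = e b 2 3 x y ∧ de b 2 x y = 0 ∧ de b 3 x y = 0

/-- `L ≅ A_{4,5}^{α,β}`: `(de¹, de², de³, de⁴) = (e¹⁴, α e²⁴, β e³⁴, 0)`. -/
def IsA45 (α β : ℝ) : Prop :=
  ∃ b : Basis (Fin 4) ℝ L, ∀ x y : L,
    de b 0 x y = e b 0 3 x y ∧ de b 1 x y = α * e b 1 3 x y ∧
      de b 2 x y = β * e b 2 3 x y ∧ de b 3 x y = 0

/-- `L ≅ A_{4,9}^α`: `(de¹, de², de³, de⁴) = ((α+1) e¹⁴ + e²³, e²⁴, α e³⁴, 0)`. -/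
def IsA49 (α : ℝ) : Prop :=
  ∃ b : Basis (Fin 4) ℝ L, ∀ x y : L,
    de b 0 x y = (α + 1) * e b 0 3 x y + e b 1 2 x y ∧ de b 1 x y = e b 1 3 x y ∧
      de b 2 x y = α * e b 2 3 x y ∧ de b 3 x y = 0

/-- `L ≅ A_{4,12}`: `(de¹, de², de³, de⁴) = (e¹³ + e²⁴, e⁴¹ + e²³, 0, 0)`. -/
def IsA412 : Prop :=
  ∃ b : Basis (Fin 4) ℝ L, ∀ x y : L,
    de b 0 x y = e b 0 2 x y + e b 1 3 x y ∧ de b 1 x y = e b 3 0 x y + e b 1 2 x y ∧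
      de b 2 x y = 0 ∧ de b 3 x y = 0

/-- `L ≅ ℝⁿ`, the abelian Lie algebra of dimension `n`. -/
def IsAbelianOfDim (n : ℕ) : Prop :=
  IsLieAbelian L ∧ Module.Finite ℝ L ∧ finrank ℝ L = n

/-- `L ≅ 𝔯₂`, the non-abelian Lie algebra of dimension two: `(de¹, de²) = (0, e¹²)`. -/
def IsR2 : Prop :=
  ∃ b : Basis (Fin 2) ℝ L, ∀ x y : L, de b 0 x y = 0 ∧ de b 1 x y = e b 0 1 x y

end Lie

end HalfFlat

end

/-!
Let `f₁, f₂` be a basis of `g₂` (`c 0`, `c 1` below). A three-form `ρ` on `g₄ × g₂` consists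
of a three-form `base ρ` on `g₄`, two two-forms `ω₁, ω₂` (`slice ρ`, the contractions with `f₁` and
`f₂`) and a linear form `α = ρ(·, f₁, f₂)` (`mixed ρ`). In these components the quartic
invariant is an explicit polynomial (`quarticInvariant_prod`), which becomes a perfect square when
enough components vanish. If `ρ` is closed, so are `ω₁` and `ω₂`, and so is `α` if `g₂` is abelian.
Let `T` be the closed linear form `x ↦ tr (ad x)`. As `d` of a three-form `X ⌟ vol` on `g₄` is
`-T(X) vol`, closedness of `base ρ` means that `base ρ` vanishes on `ker T`, if `T ≠ 0`.

If `H⁴(g₄) = 0`, then `T ≠ 0`; if moreover `h¹ = 1`, every closed linear form is a multiple of `T`,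
and if `H² = 0`, closed two-forms are exact.

* For abelian `g₂` and `h* = (1, 0, 0, 0)`, the kernel of `T` is a unimodular ideal, and has a
  basis `f 0, f 1, f 2` with `[f 0, f 1] = 0` such that `f 2` acts on the plane of `f 0, f 1` by a
  traceless endomorphism `E` (`exists_adapted_basis`). It is nilpotent, as otherwise `f.coord 2`
  would be a second closed linear form (`sq_add_mul_eq_zero`). The invariant becomes the
  discriminant of the quadratic form `f ↦ (f ⌟ ρ) ∧ (f ⌟ ρ)` on `g₂`. Since the `ωᵢ` are exact,
  `wedge_exact` expresses this form by a quadratic form on the plane with determinant `det E = 0`.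
* If `h* = (1, 0, 0, 0)` and the nilradical is abelian of dimension three, it is `ker T`. The exact
  forms `ω₁, ω₂` vanish on it, as does `base ρ`, and the invariant is the square of `α ∧ base ρ`.
* For abelian `g₂` in general, choose a closed linear form `τ ≠ 0` with `ker τ` unimodular: `T` if
  `T ≠ 0`, else `α` if `α ≠ 0`, else any closed form (one exists by
  `exists_closed_of_adTrace_eq_zero`). If a nontrivial combination of `ω₁` and `ω₂` vanishes on
  `ker τ`, it may be taken to be `ω₁`, and the invariant is a square. Otherwise `g₄` is one of the
  four exceptional algebras (`classification`): a unimodular three-dimensional ideal that is perfect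
  has only inner derivations, so `g₄` would split; if `ker τ` is not perfect, it has an adapted
  basis as above, and the cases `E = 0`, `E` nilpotent and `E` invertible are treated in turn, the
  closed two-forms restricting the action of a complement on `ker τ`.
-/

open Module

noncomputable section

namespace HalfFlat

/-! ### The shuffle expansion of the wedge product and the matrix of `K_ρ` -/

section Forms
open Equiv
variable {V : Type*} [AddCommGroup V] [Module ℝ V]

/-- Representatives of the ten `(2, 3)`-shuffles modulo permutations within the two blocks, as
products of transpositions. -/
def shuffle : Fin 10 → Perm (Fin 2 ⊕ Fin 3) :=
  ![1, swap (.inl 0) (.inr 0), swap (.inl 0) (.inr 1), swap (.inl 0) (.inr 2),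
    swap (.inl 1) (.inr 0), swap (.inl 1) (.inr 1), swap (.inl 1) (.inr 2),
    swap (.inl 0) (.inr 0) * swap (.inl 1) (.inr 1),
    swap (.inl 0) (.inr 0) * swap (.inl 1) (.inr 2),
    swap (.inl 0) (.inr 1) * swap (.inl 1) (.inr 2)]

theorem shuffle_bijective : Function.Bijective
    (fun i => (Quotient.mk'' (shuffle i) : Perm.ModSumCongr (Fin 2) (Fin 3))) := by
  rw [Fintype.bijective_iff_injective_and_card]
  constructor
  · intro i j hij
    have hij := QuotientGroup.leftRel_apply.mp (Quotient.exact' hij)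
    obtain ⟨⟨s, t⟩, h⟩ := hij
    have key : ∀ i j : Fin 10,
        (∀ a : Fin 2, (((shuffle i)⁻¹ * shuffle j) (.inl a)).isLeft) → i = j := by
      decide
    apply key
    intro a
    rw [← h]
    simp
  · have h1 : Nat.card (Perm (Fin 2 ⊕ Fin 3)) = Nat.card (Perm.ModSumCongr (Fin 2) (Fin 3)) *
        Nat.card (Perm.sumCongrHom (Fin 2) (Fin 3)).range :=
      Subgroup.card_eq_card_quotient_mul_card_subgroup (Perm.sumCongrHom (Fin 2) (Fin 3)).range
    rw [Nat.card_eq_fintype_card (α := Perm (Fin 2 ⊕ Fin 3)),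
      Nat.card_eq_fintype_card (α := (Perm.sumCongrHom (Fin 2) (Fin 3)).range),
      Perm.sumCongrHom.card_range, Fintype.card_perm, Fintype.card_prod, Fintype.card_perm,
      Fintype.card_perm, Fintype.card_sum, Fintype.card_fin, Fintype.card_fin] at h1
    rw [Fintype.card_fin, ← Nat.card_eq_fintype_card]
    rw [show Nat.factorial (2 + 3) = 120 from rfl,
      show Nat.factorial 2 * Nat.factorial 3 = 12 from rfl] at h1
    have h2 : Nat.card (Perm.ModSumCongr (Fin 2) (Fin 3)) = 10 := by omega
    exact h2.symm

theorem wedge_two_three (α : V [⋀^Fin 2]→ₗ[ℝ] ℝ) (β : V [⋀^Fin 3]→ₗ[ℝ] ℝ) (a b c d e : V) :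
    wedge 2 3 rfl α β ![a, b, c, d, e] =
      α ![a, b] * β ![c, d, e]
      - α ![c, b] * β ![a, d, e] - α ![d, b] * β ![c, a, e] - α ![e, b] * β ![c, d, a]
      - α ![a, c] * β ![b, d, e] - α ![a, d] * β ![c, b, e] - α ![a, e] * β ![c, d, b]
      + α ![c, d] * β ![a, b, e] + α ![c, e] * β ![a, d, b] + α ![d, e] * β ![c, a, b] := by
  set v : Fin 2 ⊕ Fin 3 → V := Sum.elim ![a, b] ![c, d, e] with hv
  have h : wedge 2 3 rfl α β ![a, b, c, d, e] = ∑ i : Fin 10, (LinearMap.mul' ℝ ℝ)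
      (AlternatingMap.domCoprod.summand α β (Quotient.mk'' (shuffle i)) v) := by
    have hv' : v = ![a, b, c, d, e] ∘ finSumFinEquiv := by
      ext i
      rcases i with i | i <;> fin_cases i <;> rfl
    have hsum : α.domCoprod β v
        = ∑ i : Fin 10, AlternatingMap.domCoprod.summand α β (Quotient.mk'' (shuffle i)) v := by
      rw [AlternatingMap.domCoprod_apply, sum_apply]
      exact (Fintype.sum_bijective _ shuffle_bijective _ _ fun _ => rfl).symm
    rw [← map_sum, ← hsum, hv']
    have hw : wedge 2 3 rfl α β = ((LinearMap.mul' ℝ ℝ).compAlternatingMap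
      (α.domCoprod β)).domDomCongr (finSumFinEquiv.trans (finCongr rfl)) := rfl
    rw [hw, finCongr_refl, AlternatingMap.domDomCongr_apply, LinearMap.compAlternatingMap_apply,
      Equiv.trans_refl]
  have key : ∀ σ : Perm (Fin 2 ⊕ Fin 3), (LinearMap.mul' ℝ ℝ)
      (AlternatingMap.domCoprod.summand α β (Quotient.mk'' σ) v) = ((Perm.sign σ : ℤ) : ℝ) *
        (α ![v (σ (.inl 0)), v (σ (.inl 1))] *
          β ![v (σ (.inr 0)), v (σ (.inr 1)), v (σ (.inr 2))]) := by
    intro σ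
    have e2 : (fun i : Fin 2 => v (σ (.inl i))) = ![v (σ (.inl 0)), v (σ (.inl 1))] := by
      ext i; fin_cases i <;> rfl
    have e3 : (fun i : Fin 3 => v (σ (.inr i)))
        = ![v (σ (.inr 0)), v (σ (.inr 1)), v (σ (.inr 2))] := by
      ext i; fin_cases i <;> rfl
    rw [AlternatingMap.domCoprod.summand_mk'', smul_apply,
      MultilinearMap.domDomCongr_apply, MultilinearMap.domCoprod_apply, Units.smul_def,
      map_zsmul, LinearMap.mul'_apply, zsmul_eq_mul]
    simp only [AlternatingMap.coe_multilinearMap, e2, e3]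
  simp only [h, key]
  simp [Fin.sum_univ_succ, shuffle, swap_apply_def, v]
  ring

/-- The matrix entries of `K ν ρ` in a basis. -/
theorem repr_K (b : Basis (Fin 6) ℝ V) (ν : V [⋀^Fin 6]→ₗ[ℝ] ℝ) (hν : ν ≠ 0)
    (ρ : V [⋀^Fin 3]→ₗ[ℝ] ℝ) (v : V) (i : Fin 6) :
    b.repr (K ν ρ v) i * ν b = (-1) ^ (i : ℕ) * fiveForm ρ v (i.removeNth b) := by
  have hV : finrank ℝ V = 6 := by rw [finrank_eq_card_basis b, Fintype.card_fin]
  rw [← K_spec hV ν hν, AlternatingMap.curryLeft_apply_apply]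
  have h1 : ∀ w : V, ν (Function.update b i w) = b.repr w i * ν b := by
    intro w
    conv_lhs => rw [← b.sum_repr w]
    rw [AlternatingMap.map_update_sum, Finset.sum_eq_single i]
    · rw [AlternatingMap.map_update_smul, Function.update_eq_self, smul_eq_mul]
    · intro j _ hj
      rw [AlternatingMap.map_update_smul, AlternatingMap.map_update_self _ _ hj.symm, smul_zero]
    · simp
  rw [← h1, show Function.update b i (K ν ρ v) = i.insertNth (K ν ρ v) (i.removeNth b) by
    simp [Fin.insertNth_removeNth], AlternatingMap.map_insertNth]
  simp

theorem quarticInvariant_eq_sum (b : Basis (Fin 6) ℝ V) (ν : V [⋀^Fin 6]→ₗ[ℝ] ℝ) (hν : ν ≠ 0)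
    (ρ : V [⋀^Fin 3]→ₗ[ℝ] ℝ) :
    6 * (quarticInvariant ν ρ * ν b ^ 2) = ∑ i : Fin 6, ∑ j : Fin 6,
      ((-1) ^ (i : ℕ) * fiveForm ρ (b j) (i.removeNth b)) *
        ((-1) ^ (j : ℕ) * fiveForm ρ (b i) (j.removeNth b)) := by
  simp only [← repr_K b ν hν]
  rw [quarticInvariant, LinearMap.trace_eq_matrix_trace ℝ b, LinearMap.toMatrix_comp b b b,
    Matrix.trace]
  simp only [Matrix.diag_apply, Matrix.mul_apply, LinearMap.toMatrix_apply, Finset.mul_sum,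
    Finset.sum_mul]
  exact Finset.sum_congr rfl fun i _ => Finset.sum_congr rfl fun j _ => by ring

end Forms

/-! ### The quartic invariant in coordinates -/

section Forms
variable {V : Type*} [AddCommGroup V] [Module ℝ V]

theorem fiveForm_cons (ρ : V [⋀^Fin 3]→ₗ[ℝ] ℝ) (x a b c d e : V) :
    fiveForm ρ x ![a, b, c, d, e] =
      ρ ![x, a, b] * ρ ![c, d, e]
      - ρ ![x, c, b] * ρ ![a, d, e] - ρ ![x, d, b] * ρ ![c, a, e] - ρ ![x, e, b] * ρ ![c, d, a]
      - ρ ![x, a, c] * ρ ![b, d, e] - ρ ![x, a, d] * ρ ![c, b, e] - ρ ![x, a, e] * ρ ![c, d, b]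
      + ρ ![x, c, d] * ρ ![a, b, e] + ρ ![x, c, e] * ρ ![a, d, b]
      + ρ ![x, d, e] * ρ ![c, a, b] := by
  rw [fiveForm_apply, wedge_two_three]
  rfl

/-- The quartic invariant as a polynomial in the coordinates of `ρ`. With the last two basis vectors
set apart, the coordinates are named `g` on three of the first four vectors, `p` and `q` on two of
them together with `b 4` and `b 5` respectively, and `a` on one of them together with both. -/
theorem quarticInvariant_eq (b : Basis (Fin 6) ℝ V) (ν : V [⋀^Fin 6]→ₗ[ℝ] ℝ) (hν : ν ≠ 0)
    (ρ : V [⋀^Fin 3]→ₗ[ℝ] ℝ)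
    {g012 g013 p01 q01 g023 p02 q02 p03 q03 a0 g123 p12 q12 p13 q13 a1 p23 q23 a2 a3 : ℝ}
    (hg012 : ρ ![b 0, b 1, b 2] = g012)
    (hg013 : ρ ![b 0, b 1, b 3] = g013)
    (hp01 : ρ ![b 0, b 1, b 4] = p01)
    (hq01 : ρ ![b 0, b 1, b 5] = q01)
    (hg023 : ρ ![b 0, b 2, b 3] = g023)
    (hp02 : ρ ![b 0, b 2, b 4] = p02)
    (hq02 : ρ ![b 0, b 2, b 5] = q02)
    (hp03 : ρ ![b 0, b 3, b 4] = p03)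
    (hq03 : ρ ![b 0, b 3, b 5] = q03)
    (ha0 : ρ ![b 0, b 4, b 5] = a0)
    (hg123 : ρ ![b 1, b 2, b 3] = g123)
    (hp12 : ρ ![b 1, b 2, b 4] = p12)
    (hq12 : ρ ![b 1, b 2, b 5] = q12)
    (hp13 : ρ ![b 1, b 3, b 4] = p13)
    (hq13 : ρ ![b 1, b 3, b 5] = q13)
    (ha1 : ρ ![b 1, b 4, b 5] = a1)
    (hp23 : ρ ![b 2, b 3, b 4] = p23)
    (hq23 : ρ ![b 2, b 3, b 5] = q23)
    (ha2 : ρ ![b 2, b 4, b 5] = a2)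
    (ha3 : ρ ![b 3, b 4, b 5] = a3) :
    quarticInvariant ν ρ * ν b ^ 2 =
      (a0 * g123 - a1 * g023 + a2 * g013 - a3 * g012) ^ 2
      + 2 * (a0 * g012 * (2 * p13 * q23 - 2 * p23 * q13)
         + a0 * g013 * (-2 * p12 * q23 + 2 * p23 * q12)
         + a0 * g023 * (2 * p12 * q13 - 2 * p13 * q12)
         + a0 * g123 * (p01 * q23 - p02 * q13 + p03 * q12 - p12 * q03 + p13 * q02 - p23 * q01)
         + a1 * g012 * (-2 * p03 * q23 + 2 * p23 * q03)
         + a1 * g013 * (2 * p02 * q23 - 2 * p23 * q02)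
         + a1 * g023 * (-p01 * q23 - p02 * q13 + p03 * q12 - p12 * q03 + p13 * q02 + p23 * q01)
         + a1 * g123 * (2 * p02 * q03 - 2 * p03 * q02)
         + a2 * g012 * (2 * p03 * q13 - 2 * p13 * q03)
         + a2 * g013 * (-p01 * q23 - p02 * q13 - p03 * q12 + p12 * q03 + p13 * q02 + p23 * q01)
         + a2 * g023 * (2 * p01 * q13 - 2 * p13 * q01)
         + a2 * g123 * (-2 * p01 * q03 + 2 * p03 * q01)
         + a3 * g012 * (p01 * q23 - p02 * q13 - p03 * q12 + p12 * q03 + p13 * q02 - p23 * q01)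
         + a3 * g013 * (2 * p02 * q12 - 2 * p12 * q02)
         + a3 * g023 * (-2 * p01 * q12 + 2 * p12 * q01)
         + a3 * g123 * (2 * p01 * q02 - 2 * p02 * q01))
      + (p01 * q23 - p02 * q13 + p03 * q12 + p12 * q03 - p13 * q02 + p23 * q01) ^ 2
      - 4 * (p01 * p23 - p02 * p13 + p03 * p12) * (q01 * q23 - q02 * q13 + q03 * q12) := by
  have r0 : (0 : Fin 6).removeNth b = ![b 1, b 2, b 3, b 4, b 5] := by
    ext i; fin_cases i <;> rfl
  have r1 : (1 : Fin 6).removeNth b = ![b 0, b 2, b 3, b 4, b 5] := by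
    ext i; fin_cases i <;> rfl
  have r2 : (2 : Fin 6).removeNth b = ![b 0, b 1, b 3, b 4, b 5] := by
    ext i; fin_cases i <;> rfl
  have r3 : (3 : Fin 6).removeNth b = ![b 0, b 1, b 2, b 4, b 5] := by
    ext i; fin_cases i <;> rfl
  have r4 : (4 : Fin 6).removeNth b = ![b 0, b 1, b 2, b 3, b 5] := by
    ext i; fin_cases i <;> rfl
  have r5 : (5 : Fin 6).removeNth b = ![b 0, b 1, b 2, b 3, b 4] := by
    ext i; fin_cases i <;> rfl
  obtain ⟨r, hr⟩ : ∃ r : Fin 6 → Fin 6 → Fin 6 → ℝ, ∀ i j k, ρ ![b i, b j, b k] = r i j k :=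
    ⟨_, fun _ _ _ => rfl⟩
  -- oriented so that rewriting sorts the indices
  have s1 : ∀ i j k, j < i → r i j k = -r j i k := by
    intro i j k _
    have := ρ.map_swap ![b i, b j, b k] (show (0 : Fin 3) ≠ 1 by decide)
    rw [← hr, ← hr, ← neg_eq_iff_eq_neg, ← this]
    congr 1; ext l; fin_cases l <;> rfl
  have s2 : ∀ i j k, k < j → r i j k = -r i k j := by
    intro i j k _
    have := ρ.map_swap ![b i, b j, b k] (show (1 : Fin 3) ≠ 2 by decide)
    rw [← hr, ← hr, ← neg_eq_iff_eq_neg, ← this]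
    congr 1; ext l; fin_cases l <;> rfl
  have z1 : ∀ i k, r i i k = 0 := fun i k => by
    rw [← hr]; exact ρ.map_eq_zero_of_eq _ (i := 0) (j := 1) rfl (by decide)
  have z2 : ∀ i k, r k i i = 0 := fun i k => by
    rw [← hr]; exact ρ.map_eq_zero_of_eq _ (i := 1) (j := 2) rfl (by decide)
  simp only [hr] at hg012 hg013 hp01 hq01 hg023 hp02 hq02 hp03 hq03 ha0
  simp only [hr] at hg123 hp12 hq12 hp13 hq13 ha1 hp23 hq23 ha2 ha3
  have key := quarticInvariant_eq_sum b ν hν ρ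
  simp only [Fin.sum_univ_six, r0, r1, r2, r3, r4, r5, fiveForm_cons, hr, z1,
    zero_mul, sub_zero, add_zero, zero_sub] at key
  simp (discharger := decide) only [s1, s2, z1, z2] at key
  simp only [hg012, hg013, hp01, hq01, hg023, hp02, hq02, hp03, hq03, ha0, hg123, hp12, hq12, hp13,
    hq13, ha1, hp23, hq23, ha2, ha3] at key
  norm_num at key
  linear_combination (1 / 6) * key

end Forms

/-! ### The exterior derivative of two-forms and three-forms -/

section Differential
variable {L : Type*} [LieRing L] [LieAlgebra ℝ L]

theorem d_two_apply (ω : L [⋀^Fin 2]→ₗ[ℝ] ℝ) (x y z : L) :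
    d L 2 ω ![x, y, z] = -ω ![⁅x, y⁆, z] + ω ![⁅x, z⁆, y] - ω ![⁅y, z⁆, x] := by
  rw [d_apply, Fin.sum_univ_two, show (Finset.Ici (0 : Fin 2)) = {0, 1} from by decide,
    show (Finset.Ici (1 : Fin 2)) = {1} from by decide, Finset.sum_pair (by decide),
    Finset.sum_singleton]
  have h1 : ∀ i j : Fin 2, ((j.removeNth (i.castSucc.removeNth ![x, y, z]) : Fin 1 → L))
    = ![(![x, y, z] : Fin 3 → L) (i.castSucc.succAbove (j.succAbove 0))] := by
    intro i j
    ext k; fin_cases k; rfl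
  simp only [h1]
  simp [Fin.succAbove]
  ring

theorem d_three_apply (ω : L [⋀^Fin 3]→ₗ[ℝ] ℝ) (x y z w : L) :
    d L 3 ω ![x, y, z, w] = -ω ![⁅x, y⁆, z, w] + ω ![⁅x, z⁆, y, w] - ω ![⁅x, w⁆, y, z]
      - ω ![⁅y, z⁆, x, w] + ω ![⁅y, w⁆, x, z] - ω ![⁅z, w⁆, x, y] := by
  rw [d_apply, Fin.sum_univ_three, show (Finset.Ici (0 : Fin 3)) = {0, 1, 2} from by decide,
    show (Finset.Ici (1 : Fin 3)) = {1, 2} from by decide,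
    show (Finset.Ici (2 : Fin 3)) = {2} from by decide, Finset.sum_insert (by decide),
    Finset.sum_pair (by decide), Finset.sum_pair (by decide),
    Finset.sum_singleton]
  have h1 : ∀ i j : Fin 3, ((j.removeNth (i.castSucc.removeNth ![x, y, z, w]) : Fin 2 → L))
    = ![(![x, y, z, w] : Fin 4 → L) (i.castSucc.succAbove (j.succAbove 0)),
        (![x, y, z, w] : Fin 4 → L) (i.castSucc.succAbove (j.succAbove 1))] := by
    intro i j
    ext k; fin_cases k <;> rfl
  simp only [h1]
  simp [Fin.succAbove]
  ring
end Differential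

/-! ### Bases, decomposability and the trace form -/

section Bases
variable {V : Type*} [AddCommGroup V] [Module ℝ V]

/-- A family with invertible coefficient matrix with respect to a basis is itself a basis. -/
theorem exists_basis_of_det_ne_zero {n : ℕ} (b : Basis (Fin n) ℝ V) (P : Matrix (Fin n) (Fin n) ℝ)
    (hP : P.det ≠ 0) : ∃ b' : Basis (Fin n) ℝ V, ∀ i, b' i = ∑ j, P i j • b j := by
  have h := (b.is_basis_iff_det (v := fun i => ∑ j, P i j • b j)).2 (by
    rw [Basis.det_apply, isUnit_iff_ne_zero]
    have : b.toMatrix (fun i => ∑ j, P i j • b j) = P.transpose := by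
      ext i j
      simp [Basis.toMatrix_apply, Finsupp.single_apply]
    rwa [this, Matrix.det_transpose])
  exact ⟨Basis.mk h.1 h.2.ge, fun i => by simp⟩

/-- Steinitz exchange: a basis vector may be replaced by any vector in which it occurs. -/
theorem exists_basis_update {n : ℕ} (b : Basis (Fin n) ℝ V) (i : Fin n) (v : V)
    (h : b.repr v i ≠ 0) : ∃ b' : Basis (Fin n) ℝ V, b' i = v ∧ ∀ j ≠ i, b' j = b j := by
  obtain ⟨b', hb'⟩ := exists_basis_of_det_ne_zero b
    ((1 : Matrix (Fin n) (Fin n) ℝ).updateRow i (b.repr v)) (by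
      rw [← Matrix.cramer_transpose_apply, Matrix.transpose_one, Matrix.cramer_one]
      exact h)
  refine ⟨b', ?_, fun j hj => ?_⟩
  · rw [hb']
    simp [b.sum_repr]
  · rw [hb', Finset.sum_eq_single j]
    · simp [Matrix.updateRow_ne hj]
    · intro k _ hk
      simp [Matrix.updateRow_ne hj, Matrix.one_apply_ne hk.symm]
    · simp

/-- Two independent vectors can be made the last two vectors of a basis. -/
theorem exists_basis_last_two (b : Basis (Fin 4) ℝ V) (v w : V) (hw : w ≠ 0)
    (hv : ∀ r : ℝ, v ≠ r • w) :
    ∃ b' : Basis (Fin 4) ℝ V, b' 2 = v ∧ b' 3 = w := by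
  obtain ⟨i, hi⟩ : ∃ i, b.repr w i ≠ 0 := by
    by_contra! h
    exact hw (b.repr.map_eq_zero_iff.1 (Finsupp.ext h))
  obtain ⟨c, hc, -⟩ := exists_basis_update (b.reindex (Equiv.swap i 3)) 3 w (by simpa using hi)
  obtain ⟨j, hj3, hj⟩ : ∃ j, j ≠ 3 ∧ c.repr v j ≠ 0 := by
    by_contra! h
    apply hv (c.repr v 3)
    rw [← hc]
    conv_lhs => rw [← c.sum_repr v]
    rw [Finset.sum_eq_single 3]
    · intro k _ hk
      rw [h k hk, zero_smul]
    · simp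
  obtain ⟨c', hc', hc''⟩ := exists_basis_update (c.reindex (Equiv.swap j 2)) 2 v (by simpa using hj)
  refine ⟨c', hc', ?_⟩
  rw [hc'' 3 (by decide), Basis.reindex_apply, Equiv.symm_swap,
    Equiv.swap_apply_of_ne_of_ne hj3.symm (by decide), hc]

/-- Two independent linear forms on a four-dimensional space can be made the last two coordinates
of a basis. -/
theorem exists_basis_coord (hV : finrank ℝ V = 4) (φ τ : Dual ℝ V) (hτ : τ ≠ 0)
    (hφ : ∀ r : ℝ, φ ≠ r • τ) :
    ∃ b : Basis (Fin 4) ℝ V, b.coord 2 = φ ∧ b.coord 3 = τ := by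
  have : FiniteDimensional ℝ V := FiniteDimensional.of_finrank_pos (by omega)
  obtain ⟨c, hc2, hc3⟩ := exists_basis_last_two
    (finBasisOfFinrankEq ℝ (Dual ℝ V) (by rw [Subspace.dual_finrank_eq, hV])) φ τ hτ hφ
  have key : ∀ i, (c.dualBasis.map (evalEquiv ℝ V).symm).coord i = c i := by
    intro i
    refine (c.dualBasis.map (evalEquiv ℝ V).symm).ext fun j => ?_
    rw [Basis.coord_apply, Basis.repr_self, Basis.map_apply, Module.apply_evalEquiv_symm_apply]
    rw [Basis.dualBasis_apply_self, Finsupp.single_apply]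
    simp only [eq_comm]
  exact ⟨_, (key 2).trans hc2, (key 3).trans hc3⟩

/-- A nonzero linear form on a four-dimensional space can be made the last coordinate. -/
theorem exists_basis_coord_last (hV : finrank ℝ V = 4) (τ : Dual ℝ V) (hτ : τ ≠ 0) :
    ∃ b : Basis (Fin 4) ℝ V, b.coord 3 = τ := by
  have : FiniteDimensional ℝ V := FiniteDimensional.of_finrank_pos (by omega)
  obtain ⟨φ, hφ⟩ : ∃ φ : Dual ℝ V, ∀ r : ℝ, φ ≠ r • τ := by
    by_contra! h
    have h1 : finrank ℝ (Dual ℝ V) ≤ 1 := finrank_le_one τ fun w => by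
      obtain ⟨r, hr⟩ := h w
      exact ⟨r, hr.symm⟩
    rw [Subspace.dual_finrank_eq, hV] at h1
    omega
  obtain ⟨b, -, hb⟩ := exists_basis_coord hV φ τ hτ hφ
  exact ⟨b, hb⟩

theorem eq_sum_four (b : Basis (Fin 4) ℝ V) (v : V) :
    v = b.coord 0 v • b 0 + b.coord 1 v • b 1 + b.coord 2 v • b 2 + b.coord 3 v • b 3 := by
  conv_lhs => rw [← b.sum_repr v, Fin.sum_univ_four]
  rfl

end Bases

section Indecomposable
variable {L : Type*} [LieRing L] [LieAlgebra ℝ L]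

/-- A central vector outside the kernel of a closed linear form splits off. -/
theorem not_indecomposable_of_central (hL : finrank ℝ L = 4) (v : L) (φ : Dual ℝ L)
    (hv : ∀ x : L, ⁅x, v⁆ = 0) (hφ : ∀ x y : L, φ ⁅x, y⁆ = 0) (hφv : φ v ≠ 0) :
    ¬ Indecomposable L := by
  rintro ⟨-, h⟩
  let I : LieIdeal ℝ L :=
    { ℝ ∙ v with
      lie_mem := by
        intro x m hm
        obtain ⟨r, rfl⟩ := Submodule.mem_span_singleton.1 hm
        rw [lie_smul, hv, smul_zero]
        exact Submodule.zero_mem _ }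
  let J : LieIdeal ℝ L :=
    { LinearMap.ker φ with
      lie_mem := by
        intro x m _
        exact hφ x m }
  have hI : ∀ x, x ∈ I ↔ ∃ r : ℝ, r • v = x := fun x => Submodule.mem_span_singleton
  have hJ : ∀ x, x ∈ J ↔ φ x = 0 := fun x => LinearMap.mem_ker
  have hIJ : IsCompl I J := by
    constructor
    · rw [disjoint_iff, eq_bot_iff]
      intro x hx
      obtain ⟨hx1, hx2⟩ := (LieSubmodule.mem_inf _ _ _).1 hx
      obtain ⟨r, rfl⟩ := (hI x).1 hx1
      rw [hJ, map_smul, smul_eq_mul] at hx2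
      rw [(mul_eq_zero.1 hx2).resolve_right hφv, zero_smul]
      exact LieSubmodule.zero_mem _
    · rw [codisjoint_iff, eq_top_iff]
      intro x _
      rw [LieSubmodule.mem_sup]
      refine ⟨(φ x / φ v) • v, (hI _).2 ⟨_, rfl⟩, x - (φ x / φ v) • v, (hJ _).2 ?_, by abel⟩
      rw [map_sub, map_smul, smul_eq_mul, div_mul_cancel₀ _ hφv, sub_self]
  rcases h I J hIJ with h | h
  · have : v ∈ I := (hI v).2 ⟨1, one_smul _ _⟩
    rw [h, LieSubmodule.mem_bot] at this
    rw [this, map_zero] at hφv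
    exact hφv rfl
  · have hinj : Function.Injective φ := by
      rw [injective_iff_map_eq_zero]
      intro x hx
      have : x ∈ J := (hJ x).2 hx
      rwa [h, LieSubmodule.mem_bot] at this
    have := LinearMap.finrank_le_finrank_of_injective hinj
    rw [hL, finrank_self] at this
    omega

/-- A Lie algebra is decomposable if it has a basis whose first two vectors span a subalgebra
commuting with the subalgebra spanned by the last two. -/
theorem not_indecomposable_of_basis (b : Basis (Fin 4) ℝ L) {p q : ℝ}
    (h01 : ⁅b 0, b 1⁆ = p • b 0) (h02 : ⁅b 0, b 2⁆ = 0) (h03 : ⁅b 0, b 3⁆ = 0)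
    (h12 : ⁅b 1, b 2⁆ = 0) (h13 : ⁅b 1, b 3⁆ = 0) (h23 : ⁅b 2, b 3⁆ = q • b 2) :
    ¬ Indecomposable L := by
  rintro ⟨-, h⟩
  have h10 := lie_skew (b 1) (b 0)
  have h20 := lie_skew (b 2) (b 0)
  have h30 := lie_skew (b 3) (b 0)
  have h21 := lie_skew (b 2) (b 1)
  have h31 := lie_skew (b 3) (b 1)
  have h32 := lie_skew (b 3) (b 2)
  rw [h01] at h10; rw [h02] at h20; rw [h03] at h30; rw [h12] at h21; rw [h13] at h31
  rw [h23] at h32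
  have hbr : ∀ (x y : L) (i : Fin 4), b.coord i ⁅x, y⁆ = b.coord i
      ⁅b.coord 0 x • b 0 + b.coord 1 x • b 1 + b.coord 2 x • b 2 + b.coord 3 x • b 3,
        b.coord 0 y • b 0 + b.coord 1 y • b 1 + b.coord 2 y • b 2 + b.coord 3 y • b 3⁆ :=
    fun x y i => by rw [← eq_sum_four, ← eq_sum_four]
  let I : LieIdeal ℝ L :=
    { LinearMap.ker (b.coord 2) ⊓ LinearMap.ker (b.coord 3) with
      lie_mem := by
        rintro x m ⟨h2, h3⟩
        have h2 : b.coord 2 m = 0 := h2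
        have h3 : b.coord 3 m = 0 := h3
        constructor
        · change b.coord 2 ⁅x, m⁆ = 0
          rw [hbr, h2, h3]
          simp [h01, ← h10, ← h20, ← h30, ← h21, ← h31]
        · change b.coord 3 ⁅x, m⁆ = 0
          rw [hbr, h2, h3]
          simp [h01, ← h10, ← h20, ← h30, ← h21, ← h31] }
  let J : LieIdeal ℝ L :=
    { LinearMap.ker (b.coord 0) ⊓ LinearMap.ker (b.coord 1) with
      lie_mem := by
        rintro x m ⟨h2, h3⟩
        have h2 : b.coord 0 m = 0 := h2
        have h3 : b.coord 1 m = 0 := h3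
        constructor
        · change b.coord 0 ⁅x, m⁆ = 0
          rw [hbr, h2, h3]
          simp [h02, h03, h12, h13, h23, ← h32]
        · change b.coord 1 ⁅x, m⁆ = 0
          rw [hbr, h2, h3]
          simp [h02, h03, h12, h13, h23, ← h32] }
  have hI : ∀ x, x ∈ I ↔ b.coord 2 x = 0 ∧ b.coord 3 x = 0 := fun x => Iff.rfl
  have hJ : ∀ x, x ∈ J ↔ b.coord 0 x = 0 ∧ b.coord 1 x = 0 := fun x => Iff.rfl
  have hIJ : IsCompl I J := by
    constructor
    · rw [disjoint_iff, eq_bot_iff]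
      intro x hx
      obtain ⟨hx1, hx2⟩ := (LieSubmodule.mem_inf _ _ _).1 hx
      rw [hI] at hx1
      rw [hJ] at hx2
      rw [eq_sum_four b x, hx1.1, hx1.2, hx2.1, hx2.2]
      simp
    · rw [codisjoint_iff, eq_top_iff]
      intro x _
      rw [LieSubmodule.mem_sup]
      refine ⟨b.coord 0 x • b 0 + b.coord 1 x • b 1, (hI _).2 ⟨by simp, by simp⟩,
        b.coord 2 x • b 2 + b.coord 3 x • b 3, (hJ _).2 ⟨by simp, by simp⟩, ?_⟩
      conv_rhs => rw [eq_sum_four b x]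
      abel
  rcases h I J hIJ with h | h
  · have : b 0 ∈ I := (hI _).2 ⟨by simp, by simp⟩
    rw [h, LieSubmodule.mem_bot] at this
    exact b.ne_zero 0 this
  · have : b 2 ∈ J := (hJ _).2 ⟨by simp, by simp⟩
    rw [h, LieSubmodule.mem_bot] at this
    exact b.ne_zero 2 this

end Indecomposable

section Trace
variable (L : Type*) [LieRing L] [LieAlgebra ℝ L]

/-- The linear form `x ↦ tr (ad x)`; it vanishes if and only if `L` is unimodular. -/
def adTrace : Dual ℝ L := LinearMap.trace ℝ L ∘ₗ (LieAlgebra.ad ℝ L : L →ₗ[ℝ] Module.End ℝ L)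

variable {L}

theorem adTrace_lie (x y : L) : adTrace L ⁅x, y⁆ = 0 := by
  change LinearMap.trace ℝ L (LieAlgebra.ad ℝ L ⁅x, y⁆) = 0
  have : LieAlgebra.ad ℝ L ⁅x, y⁆
      = LieAlgebra.ad ℝ L x * LieAlgebra.ad ℝ L y - LieAlgebra.ad ℝ L y * LieAlgebra.ad ℝ L x := by
    ext z
    simp
  rw [this, map_sub, LinearMap.trace_mul_comm, sub_self]

theorem adTrace_apply (b : Basis (Fin 4) ℝ L) (x : L) :
    adTrace L x = b.coord 0 ⁅x, b 0⁆ + b.coord 1 ⁅x, b 1⁆ + b.coord 2 ⁅x, b 2⁆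
      + b.coord 3 ⁅x, b 3⁆ := by
  change LinearMap.trace ℝ L (LieAlgebra.ad ℝ L x) = _
  rw [LinearMap.trace_eq_matrix_trace ℝ b, Matrix.trace, Fin.sum_univ_four]
  simp [LinearMap.toMatrix_apply]

end Trace

/-! ### Invertible action on an abelian plane: the algebra `A_{4,12}` -/

section Classification
variable {L : Type*} [LieRing L] [LieAlgebra ℝ L]

theorem lie_eq_sum_e (b : Basis (Fin 4) ℝ L) (x y : L) :
    ⁅x, y⁆ = e b 0 1 x y • ⁅b 0, b 1⁆ - e b 0 2 x y • ⁅b 2, b 0⁆ - e b 0 3 x y • ⁅b 3, b 0⁆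
      - e b 1 2 x y • ⁅b 2, b 1⁆ - e b 1 3 x y • ⁅b 3, b 1⁆ - e b 2 3 x y • ⁅b 3, b 2⁆ := by
  conv_lhs => rw [eq_sum_four b x, eq_sum_four b y]
  simp only [add_lie, lie_add, smul_lie, lie_smul, lie_self, e, smul_zero]
  rw [← lie_skew (b 0) (b 2), ← lie_skew (b 0) (b 3), ← lie_skew (b 1) (b 3),
    ← lie_skew (b 1) (b 0), ← lie_skew (b 1) (b 2), ← lie_skew (b 2) (b 3)]
  module

/-- A vector commuting with a basis is central. -/
theorem lie_eq_zero_of_basis (b : Basis (Fin 4) ℝ L) (v : L) (h : ∀ i, ⁅v, b i⁆ = 0) (x : L) :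
    ⁅x, v⁆ = 0 := by
  rw [← lie_skew, eq_sum_four b x]
  simp [h]

/-- Let `ker (b.coord 3)` be an ideal on whose abelian subalgebra spanned by `b 0, b 1` the vector
`b 2` acts by an invertible traceless endomorphism `E`. Modulo inner derivations, `b 3` acts on that
plane by a multiple of the identity, since it commutes with `E`. According to the sign of
`δ = -det E`, the algebra is `A_{4,12}` (the plane becomes the complex line) or a sum of
two-dimensional ideals (spanned by the eigenvectors of `E` and suitable combinations of `b 2` and
`b 3`). -/
theorem isA412_of_ne_zero (hL : finrank ℝ L = 4) (hind : Indecomposable L)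
    (b : Basis (Fin 4) ℝ L) {δ p0 q0 r0 p1 q1 r1 p2 q2 r2 : ℝ} (hδ : δ ≠ 0)
    (h01 : ⁅b 0, b 1⁆ = 0) (h21 : ⁅b 2, b 1⁆ = b 0) (h20 : ⁅b 2, b 0⁆ = δ • b 1)
    (h30 : ⁅b 3, b 0⁆ = p0 • b 0 + q0 • b 1 + r0 • b 2)
    (h31 : ⁅b 3, b 1⁆ = p1 • b 0 + q1 • b 1 + r1 • b 2)
    (h32 : ⁅b 3, b 2⁆ = p2 • b 0 + q2 • b 1 + r2 • b 2) : IsA412 L := by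
  have h10 : ⁅b 1, b 0⁆ = 0 := by rw [← lie_skew, h01, neg_zero]
  have h02 : ⁅b 0, b 2⁆ = -δ • b 1 := by rw [← lie_skew, h20, neg_smul]
  have h12 : ⁅b 1, b 2⁆ = -b 0 := by rw [← lie_skew, h21]
  have J1 := leibniz_lie (b 3) (b 0) (b 1)
  have J2 := leibniz_lie (b 3) (b 2) (b 1)
  have J3 := leibniz_lie (b 3) (b 2) (b 0)
  simp only [h01, h21, h20, h30, h31, h32, h10, h02, lie_add, add_lie, lie_smul, smul_lie,
    lie_self, lie_zero, smul_zero, add_zero, zero_add] at J1 J2 J3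
  have e10 := congrArg (b.coord 0) J1
  have e11 := congrArg (b.coord 1) J1
  have e20 := congrArg (b.coord 0) J2
  have e21 := congrArg (b.coord 1) J2
  have e31 := congrArg (b.coord 1) J3
  simp [hδ] at e10 e11 e20 e21 e31
  subst e10 e11
  have hr2 : r2 = 0 := by
    have : δ * (q1 - r2 - p0) = 0 := by linear_combination e31
    have := (mul_eq_zero.1 this).resolve_left hδ
    linarith
  subst hr2
  obtain rfl : q1 = p0 := by linarith
  subst e21
  -- correct `b 3` by an inner derivation so that it commutes with `b 2`
  set v := b 3 - p1 • b 2 + (q2 / δ) • b 0 + p2 • b 1 with hv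
  have hv0 : ⁅v, b 0⁆ = q1 • b 0 := by
    simp only [hv, add_lie, sub_lie, smul_lie, h30, h20, h10, lie_self]
    module
  have hv1 : ⁅v, b 1⁆ = q1 • b 1 := by
    simp only [hv, add_lie, sub_lie, smul_lie, h31, h21, h01, lie_self]
    module
  have hv2 : ⁅v, b 2⁆ = 0 := by
    simp only [hv, add_lie, sub_lie, smul_lie, h32, h02, h12, lie_self, smul_smul]
    rw [show q2 / δ * -δ = -q2 by field_simp]
    module
  obtain ⟨c, hc3, hc⟩ := exists_basis_update b 3 v (by simp [hv])
  rw [← hc3] at hv0 hv1 hv2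
  rw [← hc 0 (by decide), ← hc 1 (by decide)] at h01
  rw [← hc 0 (by decide), ← hc 1 (by decide), ← hc 2 (by decide)] at h21 h20
  rw [← hc 0 (by decide)] at hv0
  rw [← hc 1 (by decide)] at hv1
  rw [← hc 2 (by decide)] at hv2
  clear_value v
  clear hv h30 h31 h32 J1 J2 J3 h10 h02 h12 hc hc3 e20 e31
  have hp : q1 ≠ 0 := by
    rintro rfl
    rw [zero_smul] at hv0 hv1
    refine not_indecomposable_of_central hL (c 3) (c.coord 3)
      (lie_eq_zero_of_basis c _ fun i => ?_) (fun x y => ?_) (by simp) hind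
    · fin_cases i
      exacts [hv0, hv1, hv2, lie_self _]
    · rw [lie_eq_sum_e c, h01, h21, h20, hv0, hv1, hv2]
      simp
  have h10 : ⁅c 1, c 0⁆ = 0 := by rw [← lie_skew, h01, neg_zero]
  have h02 : ⁅c 0, c 2⁆ = -δ • c 1 := by rw [← lie_skew, h20, neg_smul]
  have h12 : ⁅c 1, c 2⁆ = -c 0 := by rw [← lie_skew, h21]
  have h03 : ⁅c 0, c 3⁆ = -q1 • c 0 := by rw [← lie_skew, hv0, neg_smul]
  have h13 : ⁅c 1, c 3⁆ = -q1 • c 1 := by rw [← lie_skew, hv1, neg_smul]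
  have h23 : ⁅c 2, c 3⁆ = 0 := by rw [← lie_skew, hv2, neg_zero]
  rcases lt_or_gt_of_ne hδ with hneg | hpos
  · -- complex eigenvalues
    obtain ⟨k, hk, hk2⟩ : ∃ k : ℝ, k ≠ 0 ∧ δ = -k ^ 2 :=
      ⟨√(-δ), (Real.sqrt_pos.2 (by linarith)).ne', by rw [Real.sq_sqrt (by linarith)]; ring⟩
    subst hk2
    obtain ⟨f, hf⟩ := exists_basis_of_det_ne_zero c
      !![k⁻¹, 0, 0, 0; 0, 1, 0, 0; 0, 0, 0, q1⁻¹; 0, 0, k⁻¹, 0] (by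
        simp [Matrix.det_succ_row_zero, Fin.sum_univ_succ, Fin.succAbove, hk, hp])
    have f0 : f 0 = k⁻¹ • c 0 := by rw [hf]; simp [Fin.sum_univ_four]
    have f1 : f 1 = c 1 := by rw [hf]; simp [Fin.sum_univ_four]
    have f2 : f 2 = q1⁻¹ • c 3 := by rw [hf]; simp [Fin.sum_univ_four]
    have f3 : f 3 = k⁻¹ • c 2 := by rw [hf]; simp [Fin.sum_univ_four]
    have g01 : ⁅f 0, f 1⁆ = 0 := by rw [f0, f1, smul_lie, h01, smul_zero]
    have g20 : ⁅f 2, f 0⁆ = f 0 := by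
      rw [f2, f0, smul_lie, lie_smul, hv0]
      match_scalars; field_simp
    have g21 : ⁅f 2, f 1⁆ = f 1 := by
      rw [f2, f1, smul_lie, hv1]
      match_scalars; field_simp
    have g30 : ⁅f 3, f 0⁆ = -f 1 := by
      rw [f3, f0, f1, smul_lie, lie_smul, h20]
      match_scalars; field_simp
    have g31 : ⁅f 3, f 1⁆ = f 0 := by rw [f3, f1, f0, smul_lie, h21]
    have g32 : ⁅f 3, f 2⁆ = 0 := by rw [f3, f2, smul_lie, lie_smul, h23, smul_zero, smul_zero]
    refine ⟨f, fun x y => ?_⟩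
    simp only [de]
    rw [lie_eq_sum_e f, g01, g20, g21, g30, g31, g32]
    refine ⟨?_, ?_, ?_, ?_⟩ <;> simp [e] <;> ring
  · -- real eigenvalues
    exfalso
    obtain ⟨k, hk, hk2⟩ : ∃ k : ℝ, k ≠ 0 ∧ δ = k ^ 2 :=
      ⟨√δ, (Real.sqrt_pos.2 hpos).ne', by rw [Real.sq_sqrt hpos.le]⟩
    subst hk2
    obtain ⟨f, hf⟩ := exists_basis_of_det_ne_zero c
      !![1, k, 0, 0; 0, 0, k⁻¹, q1⁻¹; 1, -k, 0, 0; 0, 0, -k⁻¹, q1⁻¹] (by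
        simp [Matrix.det_succ_row_zero, Fin.sum_univ_succ, Fin.succAbove]
        field_simp
        norm_num [hk, hp])
    have f0 : f 0 = c 0 + k • c 1 := by rw [hf]; simp [Fin.sum_univ_four]
    have f1 : f 1 = k⁻¹ • c 2 + q1⁻¹ • c 3 := by rw [hf]; simp [Fin.sum_univ_four]
    have f2 : f 2 = c 0 + -k • c 1 := by rw [hf]; simp [Fin.sum_univ_four]
    have f3 : f 3 = -k⁻¹ • c 2 + q1⁻¹ • c 3 := by rw [hf]; simp [Fin.sum_univ_four]
    refine not_indecomposable_of_basis f (p := -2) (q := -2) ?_ ?_ ?_ ?_ ?_ ?_ hind <;>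
    · simp only [f0, f1, f2, f3, lie_add, add_lie, lie_smul, smul_lie, lie_self, h01, h10, h02, h12,
        h03, h13, h23, h20, h21, hv0, hv1, hv2]
      match_scalars <;> field_simp <;> ring

end Classification

/-! ### Heisenberg and abelian ideals: the algebras `A_{4,1}`, `A_{4,9}` and `A_{4,5}` -/

section Classification
variable {L : Type*} [LieRing L] [LieAlgebra ℝ L]

/-- A bilinear form `B` on a Lie algebra is closed if it satisfies the cocycle identity; for
alternating `B` this is `dB = 0`. -/
def IsClosedForm (B : LinearMap.BilinForm ℝ L) : Prop :=
  ∀ x y z, B ⁅x, y⁆ z + B ⁅y, z⁆ x + B ⁅z, x⁆ y = 0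

/-- Coordinates in `ker τ` for a basis whose first three vectors span it. -/
theorem exists_coeff (b : Basis (Fin 4) ℝ L) (τ : Dual ℝ L) (h0 : τ (b 0) = 0) (h1 : τ (b 1) = 0)
    (h2 : τ (b 2) = 0) (h3 : τ (b 3) ≠ 0) (v : L) (hv : τ v = 0) :
    ∃ p q r : ℝ, v = p • b 0 + q • b 1 + r • b 2 := by
  have h := eq_sum_four b v
  have h4 : b.coord 3 v = 0 := by
    rw [h] at hv
    simp only [map_add, map_smul, h0, h1, h2, smul_eq_mul, mul_zero, zero_add] at hv
    exact (mul_eq_zero.1 hv).resolve_right h3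
  exact ⟨_, _, _, by rw [h, h4, zero_smul, add_zero]⟩

/-- Let `ker τ` be a Heisenberg algebra with centre spanned by `b 0`, and let `B` be a closed form
whose contraction with `b 0` does not vanish on `ker τ`, normalized by `B (b 0) (b 1) = 0`.
Closedness determines the action of `b 3` on `ker τ`, modulo inner derivations, up to a scaling `p0`
and one off-diagonal entry; `p0 ≠ 0` leads to `A_{4,9}` and `p0 = 0` to `A_{4,1}`. -/
theorem isA41_or_isA49_of_eq_zero (hL : finrank ℝ L = 4) (hind : Indecomposable L)
    (b : Basis (Fin 4) ℝ L) (τ : Dual ℝ L) (hτ : ∀ x y : L, τ ⁅x, y⁆ = 0) (h0 : τ (b 0) = 0)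
    (h1 : τ (b 1) = 0) (h2 : τ (b 2) = 0) (h3 : τ (b 3) ≠ 0)
    (h01 : ⁅b 0, b 1⁆ = 0) (h21 : ⁅b 2, b 1⁆ = b 0) (h20 : ⁅b 2, b 0⁆ = 0)
    (B : LinearMap.BilinForm ℝ L) (hB : B.IsAlt) (hBc : IsClosedForm B)
    (hB1 : B (b 0) (b 1) = 0) (hB2 : B (b 0) (b 2) ≠ 0) :
    IsA41 L ∨ IsA49 L (-1 / 2) := by
  obtain ⟨p0, q0, r0, h30⟩ := exists_coeff b τ h0 h1 h2 h3 _ (hτ (b 3) (b 0))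
  obtain ⟨p1, q1, r1, h31⟩ := exists_coeff b τ h0 h1 h2 h3 _ (hτ (b 3) (b 1))
  obtain ⟨p2, q2, r2, h32⟩ := exists_coeff b τ h0 h1 h2 h3 _ (hτ (b 3) (b 2))
  have h10 : ⁅b 1, b 0⁆ = 0 := by rw [← lie_skew, h01, neg_zero]
  have h02 : ⁅b 0, b 2⁆ = 0 := by rw [← lie_skew, h20, neg_zero]
  have h12 : ⁅b 1, b 2⁆ = -b 0 := by rw [← lie_skew, h21]
  have J1 := leibniz_lie (b 3) (b 0) (b 1)
  have J2 := leibniz_lie (b 3) (b 2) (b 1)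
  have J3 := leibniz_lie (b 3) (b 2) (b 0)
  simp only [h01, h21, h20, h30, h31, h32, h10, h02, lie_add, add_lie, lie_smul, smul_lie,
    lie_self, lie_zero, smul_zero, add_zero, zero_add] at J1 J2 J3
  have e1 := congrArg (b.coord 0) J1
  have e2 := congrArg (b.coord 0) J2
  have e3 := congrArg (b.coord 0) J3
  simp at e1 e2 e3
  subst e1 e3
  have k1 := hBc (b 3) (b 0) (b 1)
  have k2 := hBc (b 3) (b 0) (b 2)
  rw [← lie_skew (b 1) (b 3)] at k1
  rw [← lie_skew (b 2) (b 3)] at k2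
  have B20 : B (b 2) (b 0) = -B (b 0) (b 2) := (hB.neg_eq (b 0) (b 2)).symm
  have B10 : B (b 1) (b 0) = 0 := by rw [← hB.neg_eq (b 0) (b 1), hB1, neg_zero]
  have B00 : B (b 0) (b 0) = 0 := hB (b 0)
  simp only [h01, h02, h30, h31, h32, map_add, map_smul, map_neg, LinearMap.add_apply,
    LinearMap.smul_apply, LinearMap.neg_apply, LinearMap.zero_apply, map_zero, smul_eq_mul, B20,
    B10, B00, hB1] at k1 k2
  have hr1 : r1 = 0 := by
    have : r1 * B (b 0) (b 2) = 0 := by linear_combination k1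
    exact (mul_eq_zero.1 this).resolve_right hB2
  have hr2 : r2 = -p0 := by
    have : (r2 + p0) * B (b 0) (b 2) = 0 := by linear_combination k2
    linarith [(mul_eq_zero.1 this).resolve_right hB2]
  obtain rfl : q1 = 2 * p0 := by linarith
  subst hr1 hr2
  -- correct `b 3` by an inner derivation
  set v := b 3 - p1 • b 2 + p2 • b 1 with hv
  have hv0 : ⁅v, b 0⁆ = p0 • b 0 := by
    simp only [hv, add_lie, sub_lie, smul_lie, h30, h20, h10]
    module
  have hv1 : ⁅v, b 1⁆ = (2 * p0) • b 1 := by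
    simp only [hv, add_lie, sub_lie, smul_lie, h31, h21, lie_self]
    module
  have hv2 : ⁅v, b 2⁆ = q2 • b 1 + -p0 • b 2 := by
    simp only [hv, add_lie, sub_lie, smul_lie, h32, h12, lie_self]
    module
  have hτv : τ v ≠ 0 := by simpa [hv, h1, h2] using h3
  obtain ⟨c, hc3, hc⟩ := exists_basis_update b 3 v (by simp [hv])
  rw [← hc3] at hv0 hv1 hv2 hτv
  rw [← hc 0 (by decide), ← hc 1 (by decide)] at h01
  rw [← hc 0 (by decide), ← hc 1 (by decide), ← hc 2 (by decide)] at h21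
  rw [← hc 0 (by decide), ← hc 2 (by decide)] at h20
  rw [← hc 0 (by decide)] at hv0
  rw [← hc 1 (by decide)] at hv1
  rw [← hc 1 (by decide), ← hc 2 (by decide)] at hv2
  clear_value v
  clear hv h30 h31 h32 J1 J2 J3 h10 h02 h12 hc hc3 k1 k2 B20 B10 B00
  have h12 : ⁅c 1, c 2⁆ = -c 0 := by rw [← lie_skew, h21]
  by_cases hp : p0 = 0
  · subst hp
    simp only [mul_zero, zero_smul, neg_zero, add_zero] at hv0 hv1 hv2
    by_cases hq : q2 = 0
    · subst hq
      rw [zero_smul] at hv2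
      refine absurd hind (not_indecomposable_of_central hL (c 3) τ
        (lie_eq_zero_of_basis c _ fun i => ?_) hτ hτv)
      fin_cases i
      exacts [hv0, hv1, hv2, lie_self _]
    · left
      obtain ⟨f, hf⟩ := exists_basis_of_det_ne_zero c
        !![1, 0, 0, 0; 0, 1, 0, 0; 0, 0, 0, -q2⁻¹; 0, 0, 1, 0] (by
          simp [Matrix.det_succ_row_zero, Fin.sum_univ_succ, Fin.succAbove, hq])
      have f0 : f 0 = c 0 := by rw [hf]; simp [Fin.sum_univ_four]
      have f1 : f 1 = c 1 := by rw [hf]; simp [Fin.sum_univ_four]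
      have f2 : f 2 = -q2⁻¹ • c 3 := by rw [hf]; simp [Fin.sum_univ_four]
      have f3 : f 3 = c 2 := by rw [hf]; simp [Fin.sum_univ_four]
      have g01 : ⁅f 0, f 1⁆ = 0 := by rw [f0, f1, h01]
      have g20 : ⁅f 2, f 0⁆ = 0 := by rw [f2, f0, smul_lie, hv0, smul_zero]
      have g21 : ⁅f 2, f 1⁆ = 0 := by rw [f2, f1, smul_lie, hv1, smul_zero]
      have g30 : ⁅f 3, f 0⁆ = 0 := by rw [f3, f0, h20]
      have g31 : ⁅f 3, f 1⁆ = f 0 := by rw [f3, f1, f0, h21]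
      have g32 : ⁅f 3, f 2⁆ = f 1 := by
        rw [f3, f2, f1, lie_smul, ← lie_skew, hv2]
        match_scalars; field_simp
      refine ⟨f, fun x y => ?_⟩
      simp only [de]
      rw [lie_eq_sum_e f, g01, g20, g21, g30, g31, g32]
      refine ⟨?_, ?_, ?_, ?_⟩ <;> simp [e]
  · right
    obtain ⟨f, hf⟩ := exists_basis_of_det_ne_zero c
      !![1, 0, 0, 0; 0, 1, 0, 0; 0, -(q2 / (3 * p0)), 1, 0; 0, 0, 0, (2 * p0)⁻¹] (by
        simp [Matrix.det_succ_row_zero, Fin.sum_univ_succ, Fin.succAbove, hp])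
    have f0 : f 0 = c 0 := by rw [hf]; simp [Fin.sum_univ_four]
    have f1 : f 1 = c 1 := by rw [hf]; simp [Fin.sum_univ_four]
    have f2 : f 2 = -(q2 / (3 * p0)) • c 1 + c 2 := by rw [hf]; simp [Fin.sum_univ_four]
    have f3 : f 3 = (2 * p0)⁻¹ • c 3 := by rw [hf]; simp [Fin.sum_univ_four]
    have g01 : ⁅f 0, f 1⁆ = 0 := by rw [f0, f1, h01]
    have g20 : ⁅f 2, f 0⁆ = 0 := by
      rw [f2, f0, add_lie, smul_lie, ← lie_skew, h01, h20]; simp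
    have g21 : ⁅f 2, f 1⁆ = f 0 := by
      rw [f2, f1, f0, add_lie, smul_lie, lie_self, h21]; simp
    have g30 : ⁅f 3, f 0⁆ = (1 / 2 : ℝ) • f 0 := by
      rw [f3, f0, smul_lie, hv0]
      match_scalars; field_simp
    have g31 : ⁅f 3, f 1⁆ = f 1 := by
      rw [f3, f1, smul_lie, hv1]
      match_scalars; field_simp
    have g32 : ⁅f 3, f 2⁆ = (-1 / 2 : ℝ) • f 2 := by
      rw [f3, f2, smul_lie, lie_add, lie_smul, hv1, hv2]
      match_scalars <;> field_simp
      ring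
    refine ⟨f, fun x y => ?_⟩
    simp only [de]
    rw [lie_eq_sum_e f, g01, g20, g21, g30, g31, g32]
    refine ⟨?_, ?_, ?_, ?_⟩ <;> simp [e] <;> ring

/-- The normalization `B (b 0) (b 1) = 0` is achieved by a change of basis of `ker τ` that preserves
the Heisenberg brackets. -/
theorem isA41_or_isA49 (hL : finrank ℝ L = 4) (hind : Indecomposable L)
    (b : Basis (Fin 4) ℝ L) (τ : Dual ℝ L) (hτ : ∀ x y : L, τ ⁅x, y⁆ = 0) (h0 : τ (b 0) = 0)
    (h1 : τ (b 1) = 0) (h2 : τ (b 2) = 0) (h3 : τ (b 3) ≠ 0)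
    (h01 : ⁅b 0, b 1⁆ = 0) (h21 : ⁅b 2, b 1⁆ = b 0) (h20 : ⁅b 2, b 0⁆ = 0)
    (B : LinearMap.BilinForm ℝ L) (hB : B.IsAlt) (hBc : IsClosedForm B)
    (hB0 : B (b 0) (b 1) ≠ 0 ∨ B (b 0) (b 2) ≠ 0) :
    IsA41 L ∨ IsA49 L (-1 / 2) := by
  set s := B (b 0) (b 1) with hs
  set t := B (b 0) (b 2) with ht
  have hN : s ^ 2 + t ^ 2 ≠ 0 := by
    rcases hB0 with h | h
    · have := sq_pos_of_ne_zero h; nlinarith [sq_nonneg t]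
    · have := sq_pos_of_ne_zero h; nlinarith [sq_nonneg s]
  obtain ⟨c, hc⟩ := exists_basis_of_det_ne_zero b
    !![1, 0, 0, 0; 0, t, -s, 0; 0, s / (s ^ 2 + t ^ 2), t / (s ^ 2 + t ^ 2), 0; 0, 0, 0, 1] (by
      simp [Matrix.det_succ_row_zero, Fin.sum_univ_succ, Fin.succAbove]
      field_simp
      intro h
      apply hN
      linarith)
  have c0 : c 0 = b 0 := by rw [hc]; simp [Fin.sum_univ_four]
  have c1 : c 1 = t • b 1 + -s • b 2 := by rw [hc]; simp [Fin.sum_univ_four]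
  have c2 : c 2 = (s / (s ^ 2 + t ^ 2)) • b 1 + (t / (s ^ 2 + t ^ 2)) • b 2 := by
    rw [hc]; simp [Fin.sum_univ_four]
  have c3 : c 3 = b 3 := by rw [hc]; simp [Fin.sum_univ_four]
  have h12 : ⁅b 1, b 2⁆ = -b 0 := by rw [← lie_skew, h21]
  refine isA41_or_isA49_of_eq_zero hL hind c τ hτ (by rw [c0, h0]) (by simp [c1, h1, h2])
    (by simp [c2, h1, h2]) (by rwa [c3]) ?_ ?_ ?_ B hB hBc ?_ ?_
  · rw [c0, c1, lie_add, lie_smul, lie_smul, h01, ← lie_skew, h20]; simp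
  · simp only [c0, c1, c2, lie_add, add_lie, lie_smul, smul_lie, lie_self, h12, h21]
    match_scalars
    field_simp
    ring
  · rw [c0, c2, add_lie, smul_lie, smul_lie, h20, ← lie_skew, h01]; simp
  · rw [c0, c1, map_add, map_smul, map_smul, ← hs, ← ht, smul_eq_mul, smul_eq_mul]; ring
  · rw [c0, c2, map_add, map_smul, map_smul, ← hs, ← ht, smul_eq_mul, smul_eq_mul]
    have : s / (s ^ 2 + t ^ 2) * s + t / (s ^ 2 + t ^ 2) * t = 1 := by field_simp
    rw [this]
    exact one_ne_zero

/-- Let `ker τ` be abelian, and let the closed forms `B` and `C` have the kernels `ℝ ∙ b 0` and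
`ℝ ∙ b 1` on it. Closedness forces `b 3` to act by a scalar `p0` on the span of these two lines, and
by `-p0` on the quotient. -/
theorem isA45_of_kernels (hL : finrank ℝ L = 4) (hind : Indecomposable L)
    (b : Basis (Fin 4) ℝ L) (τ : Dual ℝ L) (hτ : ∀ x y : L, τ ⁅x, y⁆ = 0) (h0 : τ (b 0) = 0)
    (h1 : τ (b 1) = 0) (h2 : τ (b 2) = 0) (h3 : τ (b 3) ≠ 0)
    (h01 : ⁅b 0, b 1⁆ = 0) (h21 : ⁅b 2, b 1⁆ = 0) (h20 : ⁅b 2, b 0⁆ = 0)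
    (B C : LinearMap.BilinForm ℝ L) (hB : B.IsAlt) (hBc : IsClosedForm B)
    (hC : C.IsAlt) (hCc : IsClosedForm C)
    (B01 : B (b 0) (b 1) = 0) (B02 : B (b 0) (b 2) = 0) (B12 : B (b 1) (b 2) ≠ 0)
    (C01 : C (b 0) (b 1) = 0) (C12 : C (b 1) (b 2) = 0) (C02 : C (b 0) (b 2) ≠ 0) :
    IsA45 L (-1) 1 := by
  obtain ⟨p0, q0, r0, h30⟩ := exists_coeff b τ h0 h1 h2 h3 _ (hτ (b 3) (b 0))
  obtain ⟨p1, q1, r1, h31⟩ := exists_coeff b τ h0 h1 h2 h3 _ (hτ (b 3) (b 1))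
  obtain ⟨p2, q2, r2, h32⟩ := exists_coeff b τ h0 h1 h2 h3 _ (hτ (b 3) (b 2))
  have h10 : ⁅b 1, b 0⁆ = 0 := by rw [← lie_skew, h01, neg_zero]
  have h02 : ⁅b 0, b 2⁆ = 0 := by rw [← lie_skew, h20, neg_zero]
  have h12 : ⁅b 1, b 2⁆ = 0 := by rw [← lie_skew, h21, neg_zero]
  have key : ∀ A : LinearMap.BilinForm ℝ L, A.IsAlt → IsClosedForm A →
      p0 * A (b 0) (b 1) - r0 * A (b 1) (b 2) + q1 * A (b 0) (b 1) + r1 * A (b 0) (b 2) = 0 ∧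
      p0 * A (b 0) (b 2) + q0 * A (b 1) (b 2) + q2 * A (b 0) (b 1) + r2 * A (b 0) (b 2) = 0 ∧
      p1 * A (b 0) (b 2) + q1 * A (b 1) (b 2) - p2 * A (b 0) (b 1) + r2 * A (b 1) (b 2) = 0 := by
    intro A hA hAc
    have k1 := hAc (b 3) (b 0) (b 1)
    have k2 := hAc (b 3) (b 0) (b 2)
    have k3 := hAc (b 3) (b 1) (b 2)
    rw [← lie_skew (b 1) (b 3)] at k1
    rw [← lie_skew (b 2) (b 3)] at k2 k3
    have A20 : A (b 2) (b 0) = -A (b 0) (b 2) := (hA.neg_eq (b 0) (b 2)).symm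
    have A10 : A (b 1) (b 0) = -A (b 0) (b 1) := (hA.neg_eq (b 0) (b 1)).symm
    have A21 : A (b 2) (b 1) = -A (b 1) (b 2) := (hA.neg_eq (b 1) (b 2)).symm
    simp only [h01, h02, h12, h30, h31, h32, map_add, map_smul, map_neg, LinearMap.add_apply,
      LinearMap.smul_apply, LinearMap.neg_apply, LinearMap.zero_apply, map_zero, smul_eq_mul, A20,
      A10, A21, hA (b 0), hA (b 1), hA (b 2)] at k1 k2 k3
    refine ⟨?_, ?_, ?_⟩ <;> linarith
  obtain ⟨k1, k2, k3⟩ := key B hB hBc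
  obtain ⟨l1, l2, l3⟩ := key C hC hCc
  simp only [B01, B02, C01, C12, mul_zero, sub_zero, add_zero, zero_add, zero_sub, neg_eq_zero,
    mul_eq_zero, B12, C02, or_false, ← add_mul] at k1 k2 k3 l1 l2 l3
  subst k1 k2 l1 l3
  obtain rfl : p0 = q1 := by linarith
  obtain rfl : r2 = -p0 := by linarith
  simp only [zero_smul, add_zero, zero_add] at h30 h31
  by_cases hp : p0 = 0
  · subst hp
    exfalso
    simp only [zero_smul, add_zero, neg_zero] at h30 h31 h32
    -- a linear form that is closed because it vanishes on the only nonzero bracket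
    have hclosed : ∀ x y : L, (q2 • b.coord 0 - p2 • b.coord 1) ⁅x, y⁆ = 0 := by
      intro x y
      rw [lie_eq_sum_e b, h01, h20, h21, h30, h31, h32]
      simp
      ring
    by_cases hp2 : p2 = 0
    · by_cases hq2 : q2 = 0
      · subst hp2 hq2
        refine not_indecomposable_of_central hL (b 3) τ
          (lie_eq_zero_of_basis b _ fun i => ?_) hτ h3 hind
        fin_cases i
        exacts [h30, h31, by simpa using h32, lie_self _]
      · refine not_indecomposable_of_central hL (b 0) _
          (lie_eq_zero_of_basis b _ fun i => ?_) hclosed (by simpa using hq2) hind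
        fin_cases i
        exacts [lie_self _, h01, h02, (lie_skew (b 0) (b 3)).symm.trans (by rw [h30, neg_zero])]
    · refine not_indecomposable_of_central hL (b 1) _
        (lie_eq_zero_of_basis b _ fun i => ?_) hclosed (by simpa using hp2) hind
      fin_cases i
      exacts [h10, lie_self _, h12, (lie_skew (b 1) (b 3)).symm.trans (by rw [h31, neg_zero])]
  · obtain ⟨f, hf⟩ := exists_basis_of_det_ne_zero b
      !![1, 0, 0, 0; -(p2 / (2 * p0)), -(q2 / (2 * p0)), 1, 0; 0, 1, 0, 0; 0, 0, 0, p0⁻¹] (by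
        simp [Matrix.det_succ_row_zero, Fin.sum_univ_succ, Fin.succAbove, hp])
    have f0 : f 0 = b 0 := by rw [hf]; simp [Fin.sum_univ_four]
    have f1 : f 1 = -(p2 / (2 * p0)) • b 0 + -(q2 / (2 * p0)) • b 1 + b 2 := by
      rw [hf]; simp [Fin.sum_univ_four]
    have f2 : f 2 = b 1 := by rw [hf]; simp [Fin.sum_univ_four]
    have f3 : f 3 = p0⁻¹ • b 3 := by rw [hf]; simp [Fin.sum_univ_four]
    have g01 : ⁅f 0, f 1⁆ = 0 := by simp [f0, f1, h01, h02]
    have g20 : ⁅f 2, f 0⁆ = 0 := by rw [f2, f0, h10]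
    have g21 : ⁅f 2, f 1⁆ = 0 := by simp [f2, f1, h10, h12]
    have g30 : ⁅f 3, f 0⁆ = f 0 := by
      rw [f3, f0, smul_lie, h30]
      match_scalars; field_simp
    have g31 : ⁅f 3, f 1⁆ = -f 1 := by
      rw [f3, f1, smul_lie, lie_add, lie_add, lie_smul, lie_smul, h30, h31, h32]
      match_scalars <;> field_simp <;> ring
    have g32 : ⁅f 3, f 2⁆ = f 2 := by
      rw [f3, f2, smul_lie, h31]
      match_scalars; field_simp
    refine ⟨f, fun x y => ?_⟩
    simp only [de]
    rw [lie_eq_sum_e f, g01, g20, g21, g30, g31, g32]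
    refine ⟨?_, ?_, ?_, ?_⟩ <;> simp [e]

end Classification

/-! ### Independent closed two-forms, and perfect unimodular ideals -/

section Classification
variable {L : Type*} [LieRing L] [LieAlgebra ℝ L]

/-- The restrictions of the bilinear forms `B` and `C` to the kernel of the linear form `τ` are
linearly independent. -/
def IndepOnKer (τ : Dual ℝ L) (B C : LinearMap.BilinForm ℝ L) : Prop :=
  ∀ p q : ℝ, (∀ x y, τ x = 0 → τ y = 0 → p * B x y + q * C x y = 0) → p = 0 ∧ q = 0

/-- To vanish on `ker τ`, it suffices for an alternating form to vanish on a basis of it. -/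
theorem eq_zero_on_ker (b : Basis (Fin 4) ℝ L) (τ : Dual ℝ L) (h0 : τ (b 0) = 0)
    (h1 : τ (b 1) = 0) (h2 : τ (b 2) = 0) (h3 : τ (b 3) ≠ 0) (B : LinearMap.BilinForm ℝ L)
    (hB : B.IsAlt) (B01 : B (b 0) (b 1) = 0) (B02 : B (b 0) (b 2) = 0) (B12 : B (b 1) (b 2) = 0)
    (x y : L) (hx : τ x = 0) (hy : τ y = 0) : B x y = 0 := by
  obtain ⟨p, q, r, rfl⟩ := exists_coeff b τ h0 h1 h2 h3 x hx
  obtain ⟨p', q', r', rfl⟩ := exists_coeff b τ h0 h1 h2 h3 y hy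
  have B10 := hB.neg_eq (b 0) (b 1)
  have B20 := hB.neg_eq (b 0) (b 2)
  have B21 := hB.neg_eq (b 1) (b 2)
  simp [← B10, ← B20, ← B21, B01, B02, B12, hB (b 0), hB (b 1), hB (b 2)]

/-- Two independent vectors of `ker τ` can be made the first two vectors of an adapted basis. -/
theorem exists_basis_first_two (b : Basis (Fin 4) ℝ L) (τ : Dual ℝ L)
    (hb : ∀ j ≠ 3, τ (b j) = 0) (h3 : τ (b 3) ≠ 0) (s t : L) (hs : τ s = 0) (ht : τ t = 0)
    (hs0 : s ≠ 0) (hst : ∀ r : ℝ, t ≠ r • s) :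
    ∃ c : Basis (Fin 4) ℝ L, c 0 = s ∧ c 1 = t ∧ c 3 = b 3 ∧ ∀ j ≠ 3, τ (c j) = 0 := by
  have repr3 : ∀ (c : Basis (Fin 4) ℝ L), (∀ j ≠ 3, τ (c j) = 0) → c 3 = b 3 → ∀ v, τ v = 0 →
      c.repr v 3 = 0 := by
    intro c hc hc3 v hv
    rw [← c.sum_repr v, map_sum, Fin.sum_univ_four] at hv
    simpa [hc 0 (by decide), hc 1 (by decide), hc 2 (by decide), hc3, h3] using hv
  obtain ⟨i, hi⟩ : ∃ i, b.repr s i ≠ 0 := by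
    by_contra! h
    exact hs0 (b.repr.map_eq_zero_iff.1 (Finsupp.ext h))
  have hi3 : i ≠ 3 := by
    rintro rfl
    exact hi (repr3 b hb rfl s hs)
  obtain ⟨c, hc0, hc⟩ := exists_basis_update (b.reindex (Equiv.swap i 0)) 0 s (by simpa using hi)
  have hc3 : c 3 = b 3 := by
    rw [hc 3 (by decide), Basis.reindex_apply, Equiv.symm_swap,
      Equiv.swap_apply_of_ne_of_ne hi3.symm (by decide)]
  have hcτ : ∀ j ≠ 3, τ (c j) = 0 := by
    intro j hj
    by_cases hj0 : j = 0
    · rw [hj0, hc0, hs]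
    · rw [hc j hj0, Basis.reindex_apply, Equiv.symm_swap]
      apply hb
      rw [Ne, Equiv.swap_apply_eq_iff, Equiv.swap_apply_of_ne_of_ne hi3.symm (by decide)]
      exact hj
  obtain ⟨j, hj0, hj⟩ : ∃ j, j ≠ 0 ∧ c.repr t j ≠ 0 := by
    by_contra! h
    apply hst (c.repr t 0)
    rw [← hc0]
    conv_lhs => rw [← c.sum_repr t]
    rw [Finset.sum_eq_single 0]
    · intro k _ hk
      rw [h k hk, zero_smul]
    · simp
  have hj3 : j ≠ 3 := by
    rintro rfl
    exact hj (repr3 c hcτ hc3 t ht)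
  obtain ⟨f, hf1, hf⟩ := exists_basis_update (c.reindex (Equiv.swap j 1)) 1 t (by simpa using hj)
  refine ⟨f, ?_, hf1, ?_, fun k hk => ?_⟩
  · rw [hf 0 (by decide), Basis.reindex_apply, Equiv.symm_swap,
      Equiv.swap_apply_of_ne_of_ne hj0.symm (by decide), hc0]
  · rw [hf 3 (by decide), Basis.reindex_apply, Equiv.symm_swap,
      Equiv.swap_apply_of_ne_of_ne hj3.symm (by decide), hc3]
  · by_cases hk1 : k = 1
    · rw [hk1, hf1, ht]
    · rw [hf k hk1, Basis.reindex_apply, Equiv.symm_swap]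
      apply hcτ
      rw [Ne, Equiv.swap_apply_eq_iff, Equiv.swap_apply_of_ne_of_ne hj3.symm (by decide)]
      exact hk

theorem isA45_of_abelian_ker (hL : finrank ℝ L = 4) (hind : Indecomposable L)
    (b : Basis (Fin 4) ℝ L) (τ : Dual ℝ L) (hτ : ∀ x y : L, τ ⁅x, y⁆ = 0) (h0 : τ (b 0) = 0)
    (h1 : τ (b 1) = 0) (h2 : τ (b 2) = 0) (h3 : τ (b 3) ≠ 0)
    (h01 : ⁅b 0, b 1⁆ = 0) (h21 : ⁅b 2, b 1⁆ = 0) (h20 : ⁅b 2, b 0⁆ = 0)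
    (B C : LinearMap.BilinForm ℝ L) (hB : B.IsAlt) (hBc : IsClosedForm B)
    (hC : C.IsAlt) (hCc : IsClosedForm C) (hBC : IndepOnKer τ B C) :
    IsA45 L (-1) 1 := by
  -- an alternating form on a three-dimensional space is the contraction of the volume form with a
  -- vector, which spans its kernel
  have hker : ∀ A : LinearMap.BilinForm ℝ L, A.IsAlt → ∀ x, τ x = 0 →
      A (A (b 1) (b 2) • b 0 + -A (b 0) (b 2) • b 1 + A (b 0) (b 1) • b 2) x = 0 := by
    intro A hA x hx
    obtain ⟨p, q, r, rfl⟩ := exists_coeff b τ h0 h1 h2 h3 x hx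
    have A10 := hA.neg_eq (b 0) (b 1)
    have A20 := hA.neg_eq (b 0) (b 2)
    have A21 := hA.neg_eq (b 1) (b 2)
    simp [← A10, ← A20, ← A21, hA (b 0), hA (b 1), hA (b 2)]
    ring
  have hb : ∀ j ≠ 3, τ (b j) = 0 := by
    intro j hj
    fin_cases j
    exacts [h0, h1, h2, absurd rfl hj]
  obtain ⟨c, hc0, hc1, hc3, hc⟩ := exists_basis_first_two b τ hb h3
    (B (b 1) (b 2) • b 0 + -B (b 0) (b 2) • b 1 + B (b 0) (b 1) • b 2)
    (C (b 1) (b 2) • b 0 + -C (b 0) (b 2) • b 1 + C (b 0) (b 1) • b 2)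
    (by simp [h0, h1, h2]) (by simp [h0, h1, h2])
    (by
      intro h
      have e0 := congrArg (b.coord 0) h
      have e1 := congrArg (b.coord 1) h
      have e2 := congrArg (b.coord 2) h
      simp at e0 e1 e2
      refine one_ne_zero (hBC 1 0 fun x y hx hy => ?_).1
      rw [eq_zero_on_ker b τ h0 h1 h2 h3 B hB e2 e1 e0 x y hx hy]
      ring)
    (by
      intro r h
      have e0 := congrArg (b.coord 0) h
      have e1 := congrArg (b.coord 1) h
      have e2 := congrArg (b.coord 2) h
      simp at e0 e1 e2
      refine one_ne_zero (hBC (-r) 1 fun x y hx hy => ?_).2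
      have := eq_zero_on_ker b τ h0 h1 h2 h3 (C - r • B) (hC.sub (hB.smul r))
        (by simp [e2]) (by simp [e1]) (by simp [e0]) x y hx hy
      simp at this
      linear_combination this)
  have c0 := hc 0 (by decide)
  have c1 := hc 1 (by decide)
  have c2 := hc 2 (by decide)
  have c3 : τ (c 3) ≠ 0 := by rwa [hc3]
  have hab : ∀ x y, τ x = 0 → τ y = 0 → ⁅x, y⁆ = 0 := by
    intro x y hx hy
    obtain ⟨p, q, r, rfl⟩ := exists_coeff b τ h0 h1 h2 h3 x hx
    obtain ⟨p', q', r', rfl⟩ := exists_coeff b τ h0 h1 h2 h3 y hy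
    have h10 := lie_skew (b 1) (b 0)
    have h02 := lie_skew (b 0) (b 2)
    have h12 := lie_skew (b 1) (b 2)
    simp [h01, h20, h21, ← h10, ← h02, ← h12]
  have B0 : ∀ x, τ x = 0 → B (c 0) x = 0 := by rw [hc0]; exact hker B hB
  have C1 : ∀ x, τ x = 0 → C (c 1) x = 0 := by rw [hc1]; exact hker C hC
  have C01 : C (c 0) (c 1) = 0 := by rw [← hC.neg_eq, C1 _ c0, neg_zero]
  refine isA45_of_kernels hL hind c τ hτ c0 c1 c2 c3 (hab _ _ c0 c1) (hab _ _ c2 c1) (hab _ _ c2 c0)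
    B C hB hBc hC hCc (B0 _ c1) (B0 _ c2) ?_ C01 (C1 _ c2) ?_
  · intro h
    refine one_ne_zero (hBC 1 0 fun x y hx hy => ?_).1
    rw [eq_zero_on_ker c τ c0 c1 c2 c3 B hB (B0 _ c1) (B0 _ c2) h x y hx hy]
    ring
  · intro h
    refine one_ne_zero (hBC 0 1 fun x y hx hy => ?_).2
    rw [eq_zero_on_ker c τ c0 c1 c2 c3 C hC C01 h (C1 _ c2) x y hx hy]
    ring

/-- If the three-dimensional ideal `ker τ` is unimodular and perfect, then every derivation of it is
inner, so that it has a central complement. The hypotheses express the bracket of `ker τ` by a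
symmetric matrix `S`, as is possible for every unimodular three-dimensional Lie algebra. -/
theorem not_indecomposable_of_det_ne_zero (hL : finrank ℝ L = 4)
    (b : Basis (Fin 4) ℝ L) (τ : Dual ℝ L) (hτ : ∀ x y : L, τ ⁅x, y⁆ = 0) (h0 : τ (b 0) = 0)
    (h1 : τ (b 1) = 0) (h2 : τ (b 2) = 0) (h3 : τ (b 3) ≠ 0) {a b' c d e f : ℝ}
    (h12 : ⁅b 1, b 2⁆ = a • b 0 + d • b 1 + e • b 2)
    (h20 : ⁅b 2, b 0⁆ = d • b 0 + b' • b 1 + f • b 2)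
    (h01 : ⁅b 0, b 1⁆ = e • b 0 + f • b 1 + c • b 2)
    (hdet : a * b' * c + 2 * d * e * f - a * f ^ 2 - b' * e ^ 2 - c * d ^ 2 ≠ 0) :
    adTrace L (b 3) = 0 ∧ ¬ Indecomposable L := by
  obtain ⟨p0, q0, r0, h30⟩ := exists_coeff b τ h0 h1 h2 h3 _ (hτ (b 3) (b 0))
  obtain ⟨p1, q1, r1, h31⟩ := exists_coeff b τ h0 h1 h2 h3 _ (hτ (b 3) (b 1))
  obtain ⟨p2, q2, r2, h32⟩ := exists_coeff b τ h0 h1 h2 h3 _ (hτ (b 3) (b 2))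
  have h10 : ⁅b 1, b 0⁆ = -(e • b 0 + f • b 1 + c • b 2) := by rw [← lie_skew, h01]
  have h02 : ⁅b 0, b 2⁆ = -(d • b 0 + b' • b 1 + f • b 2) := by rw [← lie_skew, h20]
  have h21 : ⁅b 2, b 1⁆ = -(a • b 0 + d • b 1 + e • b 2) := by rw [← lie_skew, h12]
  have J0 := leibniz_lie (b 3) (b 1) (b 2)
  have J1 := leibniz_lie (b 3) (b 2) (b 0)
  have J2 := leibniz_lie (b 3) (b 0) (b 1)
  simp only [h01, h21, h20, h30, h31, h32, h10, h02, h12, lie_add, add_lie, lie_smul, smul_lie,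
    lie_self, smul_zero, add_zero, zero_add] at J0 J1 J2
  have e00 := congrArg (b.coord 0) J0
  have e01 := congrArg (b.coord 1) J0
  have e02 := congrArg (b.coord 2) J0
  have e10 := congrArg (b.coord 0) J1
  have e11 := congrArg (b.coord 1) J1
  have e12 := congrArg (b.coord 2) J1
  have e20 := congrArg (b.coord 0) J2
  have e21 := congrArg (b.coord 1) J2
  have e22 := congrArg (b.coord 2) J2
  simp at e00 e01 e02 e10 e11 e12 e20 e21 e22
  set t := p0 + q1 + r2 with ht
  -- the derivation property in the form `D S + S Dᵀ = t S`
  have m00 : 2 * (p0 * a + p1 * d + p2 * e) = t * a := by rw [ht]; linear_combination e00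
  have m11 : 2 * (q0 * d + q1 * b' + q2 * f) = t * b' := by rw [ht]; linear_combination e11
  have m22 : 2 * (r0 * e + r1 * f + r2 * c) = t * c := by rw [ht]; linear_combination e22
  have m01 : (q0 * a + q1 * d + q2 * e) + (p0 * d + p1 * b' + p2 * f) = t * d := by
    rw [ht]; linear_combination e01
  have m02 : (r0 * a + r1 * d + r2 * e) + (p0 * e + p1 * f + p2 * c) = t * e := by
    rw [ht]; linear_combination e02
  have m12 : (r0 * d + r1 * b' + r2 * f) + (q0 * e + q1 * f + q2 * c) = t * f := by
    rw [ht]; linear_combination e12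
  have ht0 : t = 0 := by
    -- contract with the adjugate of `S`
    refine (mul_eq_zero.1 (?_ : t * (a * b' * c + 2 * d * e * f - a * f ^ 2 - b' * e ^ 2
      - c * d ^ 2) = 0)).resolve_right hdet
    linear_combination -(b' * c - f ^ 2) * m00 - (a * c - e ^ 2) * m11 - (a * b' - d ^ 2) * m22
      - 2 * (e * f - d * c) * m01 - 2 * (d * f - b' * e) * m02 - 2 * (d * e - a * f) * m12
      - 2 * (a * b' * c + 2 * d * e * f - a * f ^ 2 - b' * e ^ 2 - c * d ^ 2) * ht
  have hT3 : adTrace L (b 3) = 0 := by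
    rw [← ht0, ht, adTrace_apply b, h30, h31, h32]
    simp
  refine ⟨hT3, ?_⟩
  rw [ht0, zero_mul] at m00 m11 m22 m01 m02 m12
  clear_value t
  -- `D S` is antisymmetric, so it is the cross product with a vector `w`; the derivation is the
  -- inner derivation of `S w / det S`
  set w0 := r0 * d + r1 * b' + r2 * f with hw0
  set w1 := p0 * e + p1 * f + p2 * c with hw1
  set w2 := q0 * a + q1 * d + q2 * e with hw2
  set Δ := a * b' * c + 2 * d * e * f - a * f ^ 2 - b' * e ^ 2 - c * d ^ 2 with hΔ
  set y0 := (a * w0 + d * w1 + e * w2) / Δ with hy0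
  set y1 := (d * w0 + b' * w1 + f * w2) / Δ with hy1
  set y2 := (e * w0 + f * w1 + c * w2) / Δ with hy2
  have Y0 : y0 * Δ = a * w0 + d * w1 + e * w2 := div_mul_cancel₀ _ hdet
  have Y1 : y1 * Δ = d * w0 + b' * w1 + f * w2 := div_mul_cancel₀ _ hdet
  have Y2 : y2 * Δ = e * w0 + f * w1 + c * w2 := div_mul_cancel₀ _ hdet
  clear_value y0 y1 y2
  have d00 : p0 = d * y2 - e * y1 := by
    refine mul_right_cancel₀ hdet ?_
    linear_combination (b' * c - f ^ 2) / 2 * m00 + (e * f - d * c) * m01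
      - d * Y2 + e * Y1
  have d01 : p1 = -a * y2 + e * y0 := by
    refine mul_right_cancel₀ hdet ?_
    linear_combination (e * f - d * c) / 2 * m00 + (a * c - e ^ 2) * m01
      + a * Y2 - e * Y0
  have d02 : p2 = a * y1 - d * y0 := by
    refine mul_right_cancel₀ hdet ?_
    linear_combination (d * f - b' * e) / 2 * m00 + (d * e - a * f) * m01
      - a * Y1 + d * Y0
  have d10 : q0 = b' * y2 - f * y1 := by
    refine mul_right_cancel₀ hdet ?_
    linear_combination (e * f - d * c) / 2 * m11 + (d * f - b' * e) * m12
      - b' * Y2 + f * Y1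
  have d11 : q1 = -d * y2 + f * y0 := by
    refine mul_right_cancel₀ hdet ?_
    linear_combination (a * c - e ^ 2) / 2 * m11 + (d * e - a * f) * m12
      + d * Y2 - f * Y0
  have d12 : q2 = d * y1 - b' * y0 := by
    refine mul_right_cancel₀ hdet ?_
    linear_combination (d * e - a * f) / 2 * m11 + (a * b' - d ^ 2) * m12
      - d * Y1 + b' * Y0
  have d20 : r0 = f * y2 - c * y1 := by
    refine mul_right_cancel₀ hdet ?_
    linear_combination (b' * c - f ^ 2) * m02 + (d * f - b' * e) / 2 * m22
      - f * Y2 + c * Y1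
  have d21 : r1 = -e * y2 + c * y0 := by
    refine mul_right_cancel₀ hdet ?_
    linear_combination (e * f - d * c) * m02 + (d * e - a * f) / 2 * m22
      + e * Y2 - c * Y0
  have d22 : r2 = e * y1 - f * y0 := by
    refine mul_right_cancel₀ hdet ?_
    linear_combination (d * f - b' * e) * m02 + (a * b' - d ^ 2) / 2 * m22
      - e * Y1 + f * Y0
  refine not_indecomposable_of_central hL (b 3 - (y0 • b 0 + y1 • b 1 + y2 • b 2)) τ
    (lie_eq_zero_of_basis b _ fun i => ?_) hτ (by simpa [h0, h1, h2] using h3)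
  fin_cases i
  · change ⁅_, b 0⁆ = 0
    simp only [sub_lie, add_lie, smul_lie, h30, h10, h20, lie_self, d00, d10, d20]
    module
  · change ⁅_, b 1⁆ = 0
    simp only [sub_lie, add_lie, smul_lie, h31, h01, h21, lie_self, d01, d11, d21]
    module
  · change ⁅_, b 2⁆ = 0
    simp only [sub_lie, add_lie, smul_lie, h32, h02, h12, lie_self, d02, d12, d22]
    module
  · change ⁅_, b 3⁆ = 0
    have h03 := lie_skew (b 0) (b 3)
    have h13 := lie_skew (b 1) (b 3)
    have h23 := lie_skew (b 2) (b 3)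
    simp only [sub_lie, add_lie, smul_lie, lie_self, ← h03, ← h13, ← h23, h30, h31, h32,
      d00, d10, d20, d01, d11, d21, d02, d12, d22]
    module

end Classification

/-! ### Classification of the exceptional algebras -/

section Classification
variable {L : Type*} [LieRing L] [LieAlgebra ℝ L]

/-- The classification when `ker τ` is spanned by an abelian ideal, the plane of `b 0` and `b 1`,
and a vector `b 2` acting on it by a traceless endomorphism `E`. The cases `E = 0`, `E ≠ 0`
nilpotent and `E` invertible lead to `A_{4,5}`, to `A_{4,1}` or `A_{4,9}`, and to `A_{4,12}`. -/
theorem classification_of_abelian_ideal (hL : finrank ℝ L = 4) (hind : Indecomposable L)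
    (b : Basis (Fin 4) ℝ L) (τ : Dual ℝ L) (hτ : ∀ x y : L, τ ⁅x, y⁆ = 0) (h0 : τ (b 0) = 0)
    (h1 : τ (b 1) = 0) (h2 : τ (b 2) = 0) (h3 : τ (b 3) ≠ 0) {a c d : ℝ}
    (h01 : ⁅b 0, b 1⁆ = 0) (h20 : ⁅b 2, b 0⁆ = a • b 0 + c • b 1)
    (h21 : ⁅b 2, b 1⁆ = d • b 0 + -a • b 1)
    (B C : LinearMap.BilinForm ℝ L) (hB : B.IsAlt) (hBc : IsClosedForm B)
    (hC : C.IsAlt) (hCc : IsClosedForm C) (hBC : IndepOnKer τ B C) :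
    IsA41 L ∨ IsA45 L (-1) 1 ∨ IsA49 L (-1 / 2) ∨ IsA412 L := by
  by_cases h : a = 0 ∧ c = 0 ∧ d = 0
  · obtain ⟨rfl, rfl, rfl⟩ := h
    exact Or.inr (Or.inl (isA45_of_abelian_ker hL hind b τ hτ h0 h1 h2 h3 h01 (by simpa using h21)
      (by simpa using h20) B C hB hBc hC hCc hBC))
  -- a traceless nonzero endomorphism of the plane has a cyclic vector `u • b 0 + v • b 1`
  obtain ⟨u, v, huv⟩ : ∃ u v : ℝ, (a * u + d * v) * v - (c * u - a * v) * u ≠ 0 := by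
    by_contra! h'
    apply h
    have e1 := h' 1 0
    have e2 := h' 0 1
    have e3 := h' 1 1
    refine ⟨?_, ?_, ?_⟩ <;> linarith
  obtain ⟨f, hf⟩ := exists_basis_of_det_ne_zero b
    !![a * u + d * v, c * u - a * v, 0, 0; u, v, 0, 0; 0, 0, 1, 0; 0, 0, 0, 1] (by
      simp [Matrix.det_succ_row_zero, Fin.sum_univ_succ, Fin.succAbove]
      intro h
      apply huv
      linarith)
  have f0 : f 0 = (a * u + d * v) • b 0 + (c * u - a * v) • b 1 := by
    rw [hf]; simp [Fin.sum_univ_four]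
  have f1 : f 1 = u • b 0 + v • b 1 := by rw [hf]; simp [Fin.sum_univ_four]
  have f2 : f 2 = b 2 := by rw [hf]; simp [Fin.sum_univ_four]
  have f3 : f 3 = b 3 := by rw [hf]; simp [Fin.sum_univ_four]
  have h10 := lie_skew (b 1) (b 0)
  have g01 : ⁅f 0, f 1⁆ = 0 := by
    simp [f0, f1, h01, ← h10]
  have g21 : ⁅f 2, f 1⁆ = f 0 := by
    simp only [f0, f1, f2, lie_add, lie_smul, h20, h21]
    module
  have g20 : ⁅f 2, f 0⁆ = (a ^ 2 + c * d) • f 1 := by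
    simp only [f0, f1, f2, lie_add, lie_smul, h20, h21]
    module
  have k0 : τ (f 0) = 0 := by simp [f0, h0, h1]
  have k1 : τ (f 1) = 0 := by simp [f1, h0, h1]
  have k2 : τ (f 2) = 0 := by rw [f2, h2]
  have k3 : τ (f 3) ≠ 0 := by rwa [f3]
  by_cases hδ : a ^ 2 + c * d = 0
  · rw [hδ, zero_smul] at g20
    suffices IsA41 L ∨ IsA49 L (-1 / 2) by tauto
    by_cases hB0 : B (f 0) (f 1) = 0 ∧ B (f 0) (f 2) = 0
    · by_cases hC0 : C (f 0) (f 1) = 0 ∧ C (f 0) (f 2) = 0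
      · exfalso
        -- both forms restrict to multiples of the same decomposable form
        have hp : C (f 1) (f 2) = 0 ∧ -B (f 1) (f 2) = 0 := by
          refine hBC _ _ fun x y hx hy => ?_
          have := eq_zero_on_ker f τ k0 k1 k2 k3 (C (f 1) (f 2) • B - B (f 1) (f 2) • C)
            ((hB.smul _).sub (hC.smul _)) (by simp [hB0, hC0]) (by simp [hB0, hC0])
            (by simp; ring) x y hx hy
          simp at this
          linear_combination this
        refine one_ne_zero (hBC 1 0 fun x y hx hy => ?_).1
        rw [eq_zero_on_ker f τ k0 k1 k2 k3 B hB hB0.1 hB0.2 (by simpa using hp.2) x y hx hy]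
        ring
      · exact isA41_or_isA49 hL hind f τ hτ k0 k1 k2 k3 g01 g21 g20 C hC hCc (by tauto)
    · exact isA41_or_isA49 hL hind f τ hτ k0 k1 k2 k3 g01 g21 g20 B hB hBc (by tauto)
  · obtain ⟨p0, q0, r0, h30⟩ := exists_coeff f τ k0 k1 k2 k3 _ (hτ (f 3) (f 0))
    obtain ⟨p1, q1, r1, h31⟩ := exists_coeff f τ k0 k1 k2 k3 _ (hτ (f 3) (f 1))
    obtain ⟨p2, q2, r2, h32⟩ := exists_coeff f τ k0 k1 k2 k3 _ (hτ (f 3) (f 2))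
    exact Or.inr (Or.inr (Or.inr (isA412_of_ne_zero hL hind f hδ g01 g21 g20 h30 h31 h32)))

/-- A linear form vanishing on the brackets of a basis of `ker (b.coord 3)` vanishes on all
brackets of that ideal. -/
theorem apply_lie_ker_eq_zero (b : Basis (Fin 4) ℝ L) (η : Dual ℝ L) (h01 : η ⁅b 0, b 1⁆ = 0)
    (h20 : η ⁅b 2, b 0⁆ = 0) (h21 : η ⁅b 2, b 1⁆ = 0) (x y : L) (hx : b.coord 3 x = 0)
    (hy : b.coord 3 y = 0) : η ⁅x, y⁆ = 0 := by
  rw [lie_eq_sum_e b]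
  simp [e, hx, hy, h01, h20, h21] at *

/-- If the three-dimensional ideal `ker τ` is unimodular, it is the extension of a line by an
abelian ideal of dimension two, unless it splits off. -/
theorem exists_adapted_basis (hL : finrank ℝ L = 4) (τ : Dual ℝ L) (hτ0 : τ ≠ 0)
    (hτ : ∀ x y : L, τ ⁅x, y⁆ = 0) (hT : ∀ x, τ x = 0 → adTrace L x = 0)
    (hsplit : adTrace L ≠ 0 ∨ Indecomposable L) :
    ∃ (f : Basis (Fin 4) ℝ L) (a c d : ℝ), f.coord 3 = τ ∧ ⁅f 0, f 1⁆ = 0 ∧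
      ⁅f 2, f 0⁆ = a • f 0 + c • f 1 ∧ ⁅f 2, f 1⁆ = d • f 0 + -a • f 1 := by
  obtain ⟨b, hb⟩ := exists_basis_coord_last hL τ hτ0
  subst hb
  have t0 := hT (b 0) (by simp)
  have t1 := hT (b 1) (by simp)
  have t2 := hT (b 2) (by simp)
  obtain ⟨a1, a2, a3, h12⟩ := exists_coeff b _ (by simp) (by simp) (by simp) (by simp) _
    (hτ (b 1) (b 2))
  obtain ⟨b1, b2, b3, h20⟩ := exists_coeff b _ (by simp) (by simp) (by simp) (by simp) _
    (hτ (b 2) (b 0))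
  obtain ⟨c1, c2, c3, h01⟩ := exists_coeff b _ (by simp) (by simp) (by simp) (by simp) _
    (hτ (b 0) (b 1))
  rw [adTrace_apply b, hτ, ← lie_skew (b 0) (b 2), h20, h01] at t0
  rw [adTrace_apply b, hτ, ← lie_skew (b 1) (b 0), h01, h12] at t1
  rw [adTrace_apply b, hτ, ← lie_skew (b 2) (b 1), h12, h20] at t2
  simp at t0 t1 t2
  obtain rfl : b3 = c2 := by linarith
  obtain rfl : c1 = a3 := by linarith
  obtain rfl : b1 = a2 := by linarith
  -- unimodularity makes the coefficient matrix of `ker τ` symmetric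
  by_cases hdet : a1 * b2 * c3 + 2 * b1 * c1 * b3 - a1 * b3 ^ 2 - b2 * c1 ^ 2 - c3 * b1 ^ 2 = 0
  swap
  · exfalso
    obtain ⟨hT3, hind⟩ := not_indecomposable_of_det_ne_zero hL b _ hτ (by simp) (by simp) (by simp)
      (by simp) h12 h20 h01 hdet
    refine hsplit.resolve_right hind (b.ext fun i => ?_)
    fin_cases i
    exacts [hT _ (by simp), hT _ (by simp), hT _ (by simp), hT3]
  -- a linear form on `ker τ` annihilating its brackets
  obtain ⟨w, hw0, hw⟩ := (Matrix.exists_mulVec_eq_zero_iff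
    (M := !![a1, b1, c1; b1, b2, b3; c1, b3, c3])).2 (by
      rw [Matrix.det_fin_three]; simp; linear_combination hdet)
  have w0 := congrFun hw 0
  have w1 := congrFun hw 1
  have w2 := congrFun hw 2
  simp [Matrix.mulVec, dotProduct, Fin.sum_univ_three] at w0 w1 w2
  set η : Dual ℝ L := w 0 • b.coord 0 + w 1 • b.coord 1 + w 2 • b.coord 2 with hη
  have hη' : ∀ r : ℝ, η ≠ r • b.coord 3 := by
    intro r h
    apply hw0
    ext i
    fin_cases i
    · simpa [hη] using LinearMap.congr_fun h (b 0)
    · simpa [hη] using LinearMap.congr_fun h (b 1)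
    · simpa [hη] using LinearMap.congr_fun h (b 2)
  have hηlie : ∀ x y, b.coord 3 x = 0 → b.coord 3 y = 0 → η ⁅x, y⁆ = 0 := by
    refine apply_lie_ker_eq_zero b η ?_ ?_ ?_
    · rw [h01, hη]; simp; linear_combination w2
    · rw [h20, hη]; simp; linear_combination w1
    · rw [← lie_skew, h12, hη]; simp; linear_combination -w0
  obtain ⟨f, hf2, hf3⟩ := exists_basis_coord hL η (b.coord 3) hτ0 hη'
  rw [← hf3] at hτ hT hηlie
  rw [← hf2] at hηlie
  clear_value η
  clear t0 t1 t2 h12 h20 h01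
  have t0 := hT (f 0) (by simp)
  have t1 := hT (f 1) (by simp)
  have t2 := hT (f 2) (by simp)
  have form : ∀ x y, f.coord 3 x = 0 → f.coord 3 y = 0 →
      ⁅x, y⁆ = f.coord 0 ⁅x, y⁆ • f 0 + f.coord 1 ⁅x, y⁆ • f 1 := by
    intro x y hx hy
    conv_lhs => rw [eq_sum_four f ⁅x, y⁆, hτ, hηlie x y hx hy]
    simp
  have h01 := form (f 0) (f 1) (by simp) (by simp)
  have h20 := form (f 2) (f 0) (by simp) (by simp)
  have h21 := form (f 2) (f 1) (by simp) (by simp)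
  have l02 := hηlie (f 0) (f 2) (by simp) (by simp)
  have l12 := hηlie (f 1) (f 2) (by simp) (by simp)
  rw [adTrace_apply f, hτ, l02, lie_self] at t0
  rw [adTrace_apply f, hτ, l12, lie_self, ← lie_skew (f 1) (f 0)] at t1
  rw [adTrace_apply f, hτ, lie_self] at t2
  simp only [map_zero, map_neg, add_zero, zero_add] at t0 t1 t2
  rw [t0, neg_eq_zero.1 t1, zero_smul, zero_smul, add_zero] at h01
  rw [show f.coord 1 ⁅f 2, f 1⁆ = -f.coord 0 ⁅f 2, f 0⁆ by linarith] at h21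
  exact ⟨f, _, _, _, hf3, h01, h20, h21⟩

/-- An indecomposable four-dimensional Lie algebra is one of the four exceptions if it has a
three-dimensional unimodular ideal `ker τ ⊇ [L, L]` and two closed two-forms that are linearly
independent on it. -/
theorem classification (hL : finrank ℝ L = 4) (hind : Indecomposable L)
    (τ : Dual ℝ L) (hτ0 : τ ≠ 0) (hτ : ∀ x y : L, τ ⁅x, y⁆ = 0)
    (hT : ∀ x, τ x = 0 → adTrace L x = 0)
    (B C : LinearMap.BilinForm ℝ L) (hB : B.IsAlt) (hBc : IsClosedForm B)
    (hC : C.IsAlt) (hCc : IsClosedForm C) (hBC : IndepOnKer τ B C) :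
    IsA41 L ∨ IsA45 L (-1) 1 ∨ IsA49 L (-1 / 2) ∨ IsA412 L := by
  obtain ⟨f, a, c, d, rfl, h01, h20, h21⟩ := exists_adapted_basis hL τ hτ0 hτ hT (Or.inr hind)
  exact classification_of_abelian_ideal hL hind f _ hτ (by simp) (by simp) (by simp) (by simp)
    h01 h20 h21 B C hB hBc hC hCc hBC

end Classification

/-! ### Wedge products of exact two-forms and the trace form -/

section Closed
variable {L : Type*} [LieRing L] [LieAlgebra ℝ L]

theorem three_form_apply (b : Basis (Fin 4) ℝ L) (η : L [⋀^Fin 3]→ₗ[ℝ] ℝ) (v x y : L) :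
    η ![v, x, y] = b.coord 0 v * η ![b 0, x, y] + b.coord 1 v * η ![b 1, x, y]
      + b.coord 2 v * η ![b 2, x, y] + b.coord 3 v * η ![b 3, x, y] := by
  have h : ∀ w : L, η ![w, x, y] = AlternatingMap.curryLeft η w ![x, y] := fun _ => rfl
  simp only [h]
  conv_lhs => rw [eq_sum_four b v]
  simp only [map_add, map_smul, AlternatingMap.add_apply, AlternatingMap.smul_apply, smul_eq_mul]

theorem three_form_swap_left {V : Type*} [AddCommGroup V] [Module ℝ V] (η : V [⋀^Fin 3]→ₗ[ℝ] ℝ)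
    (x y z : V) : η ![x, y, z] = -η ![y, x, z] := by
  have := η.map_swap ![x, y, z] (show (0 : Fin 3) ≠ 1 by decide)
  rw [← neg_eq_iff_eq_neg, ← this]
  congr 1; ext l; fin_cases l <;> rfl

theorem three_form_swap_right {V : Type*} [AddCommGroup V] [Module ℝ V] (η : V [⋀^Fin 3]→ₗ[ℝ] ℝ)
    (x y z : V) : η ![x, y, z] = -η ![x, z, y] := by
  have := η.map_swap ![x, y, z] (show (1 : Fin 3) ≠ 2 by decide)
  rw [← neg_eq_iff_eq_neg, ← this]
  congr 1; ext l; fin_cases l <;> rfl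

theorem three_form_self_left {V : Type*} [AddCommGroup V] [Module ℝ V] (η : V [⋀^Fin 3]→ₗ[ℝ] ℝ)
    (x z : V) : η ![x, x, z] = 0 :=
  η.map_eq_zero_of_eq _ (i := 0) (j := 1) rfl (by decide)

theorem three_form_self_right {V : Type*} [AddCommGroup V] [Module ℝ V] (η : V [⋀^Fin 3]→ₗ[ℝ] ℝ)
    (x z : V) : η ![z, x, x] = 0 :=
  η.map_eq_zero_of_eq _ (i := 1) (j := 2) rfl (by decide)

/-- If a three-form is the contraction of a vector `X` with a volume form, its differential is
`-tr (ad X)` times the volume form. -/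
theorem d_three_basis (b : Basis (Fin 4) ℝ L) (η : L [⋀^Fin 3]→ₗ[ℝ] ℝ) :
    d L 3 η ![b 0, b 1, b 2, b 3] =
      -adTrace L (b 0) * η ![b 1, b 2, b 3] + adTrace L (b 1) * η ![b 0, b 2, b 3]
      - adTrace L (b 2) * η ![b 0, b 1, b 3] + adTrace L (b 3) * η ![b 0, b 1, b 2] := by
  have self3 : ∀ x z : L, η ![x, z, x] = 0 := fun x z => by
    rw [three_form_swap_left, three_form_self_right, neg_zero]
  rw [d_three_apply, three_form_apply b η ⁅b 0, b 1⁆, three_form_apply b η ⁅b 0, b 2⁆,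
    three_form_apply b η ⁅b 0, b 3⁆, three_form_apply b η ⁅b 1, b 2⁆,
    three_form_apply b η ⁅b 1, b 3⁆, three_form_apply b η ⁅b 2, b 3⁆]
  simp only [three_form_self_left, self3, adTrace_apply b, lie_self, map_zero]
  rw [← lie_skew (b 1) (b 0), ← lie_skew (b 2) (b 0), ← lie_skew (b 3) (b 0),
    ← lie_skew (b 2) (b 1), ← lie_skew (b 3) (b 1), ← lie_skew (b 3) (b 2),
    three_form_swap_left η (b 1) (b 0), three_form_swap_left η (b 2) (b 0),
    three_form_swap_left η (b 2) (b 1), three_form_swap_left η (b 3) (b 0),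
    three_form_swap_left η (b 3) (b 1), three_form_swap_right η (b 0) (b 3),
    three_form_swap_right η (b 1) (b 3)]
  rw [three_form_swap_left η (b 3) (b 0), three_form_swap_left η (b 2) (b 0),
    three_form_swap_right η (b 0) (b 3)]
  rw [three_form_swap_left η (b 1) (b 0) (b 2), three_form_swap_right η (b 0) (b 2) (b 1)]
  simp only [map_neg]
  ring

/-- The coordinate form of `dσ ∧ dτ = d(σ ∧ dτ) = -tr (ad X) vol` for linear forms `σ` and `τ` on a
four-dimensional Lie algebra, where `X` is the vector whose contraction with `vol` is `σ ∧ dτ`. -/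
theorem wedge_exact (b : Basis (Fin 4) ℝ L) (σ τ : Dual ℝ L) :
    σ ⁅b 0, b 1⁆ * τ ⁅b 2, b 3⁆ - σ ⁅b 0, b 2⁆ * τ ⁅b 1, b 3⁆ + σ ⁅b 0, b 3⁆ * τ ⁅b 1, b 2⁆
      + σ ⁅b 1, b 2⁆ * τ ⁅b 0, b 3⁆ - σ ⁅b 1, b 3⁆ * τ ⁅b 0, b 2⁆ + σ ⁅b 2, b 3⁆ * τ ⁅b 0, b 1⁆ =
    (σ (b 1) * τ ⁅b 2, b 3⁆ - σ (b 2) * τ ⁅b 1, b 3⁆ + σ (b 3) * τ ⁅b 1, b 2⁆) * adTrace L (b 0)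
    - (σ (b 0) * τ ⁅b 2, b 3⁆ - σ (b 2) * τ ⁅b 0, b 3⁆ + σ (b 3) * τ ⁅b 0, b 2⁆) * adTrace L (b 1)
    + (σ (b 0) * τ ⁅b 1, b 3⁆ - σ (b 1) * τ ⁅b 0, b 3⁆ + σ (b 3) * τ ⁅b 0, b 1⁆) * adTrace L (b 2)
    - (σ (b 0) * τ ⁅b 1, b 2⁆ - σ (b 1) * τ ⁅b 0, b 2⁆ + σ (b 2) * τ ⁅b 0, b 1⁆)
      * adTrace L (b 3) := by
  have hσ : ∀ v, σ v = b.coord 0 v * σ (b 0) + b.coord 1 v * σ (b 1) + b.coord 2 v * σ (b 2)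
      + b.coord 3 v * σ (b 3) := fun v => by
    conv_lhs => rw [eq_sum_four b v]
    simp only [map_add, map_smul, smul_eq_mul]
  have hτ : ∀ v z, τ ⁅v, z⁆ = b.coord 0 v * τ ⁅b 0, z⁆ + b.coord 1 v * τ ⁅b 1, z⁆
      + b.coord 2 v * τ ⁅b 2, z⁆ + b.coord 3 v * τ ⁅b 3, z⁆ := fun v z => by
    conv_lhs => rw [eq_sum_four b v]
    simp only [add_lie, smul_lie, map_add, map_smul, smul_eq_mul]
  have J : ∀ x y z : L, τ ⁅⁅x, y⁆, z⁆ - τ ⁅⁅x, z⁆, y⁆ + τ ⁅⁅y, z⁆, x⁆ = 0 := by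
    intro x y z
    have h := lie_jacobi x y z
    rw [← lie_skew x ⁅y, z⁆, ← lie_skew y ⁅z, x⁆, ← lie_skew z ⁅x, y⁆, ← lie_skew z x, neg_lie,
      neg_neg] at h
    have h' := congrArg τ h
    simp only [map_add, map_neg, map_zero] at h'
    linarith
  have T0 := adTrace_apply b (b 0)
  have T1 := adTrace_apply b (b 1)
  have T2 := adTrace_apply b (b 2)
  have T3 := adTrace_apply b (b 3)
  have J0 := J (b 1) (b 2) (b 3)
  have J1 := J (b 0) (b 2) (b 3)
  have J2 := J (b 0) (b 1) (b 3)
  have J3 := J (b 0) (b 1) (b 2)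
  rw [hτ ⁅b 1, b 2⁆, hτ ⁅b 1, b 3⁆, hτ ⁅b 2, b 3⁆] at J0
  rw [hτ ⁅b 0, b 2⁆, hτ ⁅b 0, b 3⁆, hτ ⁅b 2, b 3⁆] at J1
  rw [hτ ⁅b 0, b 1⁆, hτ ⁅b 0, b 3⁆, hτ ⁅b 1, b 3⁆] at J2
  rw [hτ ⁅b 0, b 1⁆, hτ ⁅b 0, b 2⁆, hτ ⁅b 1, b 2⁆] at J3
  rw [hσ ⁅b 0, b 1⁆, hσ ⁅b 0, b 2⁆, hσ ⁅b 0, b 3⁆, hσ ⁅b 1, b 2⁆, hσ ⁅b 1, b 3⁆, hσ ⁅b 2, b 3⁆]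
  simp only [← lie_skew (b 1) (b 0), ← lie_skew (b 2) (b 0), ← lie_skew (b 3) (b 0),
    ← lie_skew (b 2) (b 1), ← lie_skew (b 3) (b 1), ← lie_skew (b 3) (b 2), map_neg, lie_self,
    map_zero, mul_neg, mul_zero] at T0 T1 T2 T3 J0 J1 J2 J3
  linear_combination
    -(σ (b 1) * τ ⁅b 2, b 3⁆ - σ (b 2) * τ ⁅b 1, b 3⁆ + σ (b 3) * τ ⁅b 1, b 2⁆) * T0
    + (σ (b 0) * τ ⁅b 2, b 3⁆ - σ (b 2) * τ ⁅b 0, b 3⁆ + σ (b 3) * τ ⁅b 0, b 2⁆) * T1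
    - (σ (b 0) * τ ⁅b 1, b 3⁆ - σ (b 1) * τ ⁅b 0, b 3⁆ + σ (b 3) * τ ⁅b 0, b 1⁆) * T2
    + (σ (b 0) * τ ⁅b 1, b 2⁆ - σ (b 1) * τ ⁅b 0, b 2⁆ + σ (b 2) * τ ⁅b 0, b 1⁆) * T3
    + σ (b 0) * J0 - σ (b 1) * J1 + σ (b 2) * J2 - σ (b 3) * J3

/-- A unimodular four-dimensional Lie algebra is not perfect: otherwise `d` would be injective on
linear forms, and by `wedge_exact` its image would be a four-dimensional isotropic subspace of the
six-dimensional space of two-forms with the wedge pairing. -/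
theorem exists_closed_of_adTrace_eq_zero (b : Basis (Fin 4) ℝ L) (hT : adTrace L = 0) :
    ∃ τ : Dual ℝ L, τ ≠ 0 ∧ ∀ x y : L, τ ⁅x, y⁆ = 0 := by
  by_contra! hcl
  have hzero : ∀ τ : Dual ℝ L, τ ⁅b 0, b 1⁆ = 0 → τ ⁅b 0, b 2⁆ = 0 → τ ⁅b 0, b 3⁆ = 0 →
      τ ⁅b 1, b 2⁆ = 0 → τ ⁅b 1, b 3⁆ = 0 → τ ⁅b 2, b 3⁆ = 0 → τ = 0 := by
    intro τ h01 h02 h03 h12 h13 h23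
    by_contra h
    obtain ⟨x, y, hxy⟩ := hcl τ h
    apply hxy
    rw [lie_eq_sum_e b, ← lie_skew (b 2) (b 0), ← lie_skew (b 3) (b 0), ← lie_skew (b 2) (b 1),
      ← lie_skew (b 3) (b 1), ← lie_skew (b 3) (b 2)]
    simp only [map_sub, map_smul, map_neg, h01, h02, h03, h12, h13, h23]
    simp
  have hg : ∀ g : Fin 4 → ℝ, (∑ k, g k • b.coord k) = 0 → ∀ k, g k = 0 := by
    intro g h k
    have := LinearMap.congr_fun h (b k)
    fin_cases k <;> simpa [Fin.sum_univ_four] using this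
  -- the coordinates of the forms `dbᵏ`, and those of the functionals `dbˡ ∧ ·`
  let M : Matrix (Fin 4) (Fin 6) ℝ := Matrix.of fun k =>
    ![b.coord k ⁅b 0, b 1⁆, b.coord k ⁅b 0, b 2⁆, b.coord k ⁅b 0, b 3⁆, b.coord k ⁅b 1, b 2⁆,
      b.coord k ⁅b 1, b 3⁆, b.coord k ⁅b 2, b 3⁆]
  let N : Matrix (Fin 4) (Fin 6) ℝ := Matrix.of fun k =>
    ![b.coord k ⁅b 2, b 3⁆, -b.coord k ⁅b 1, b 3⁆, b.coord k ⁅b 1, b 2⁆, b.coord k ⁅b 0, b 3⁆,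
      -b.coord k ⁅b 0, b 2⁆, b.coord k ⁅b 0, b 1⁆]
  have hM : LinearIndependent ℝ M.row := by
    rw [Fintype.linearIndependent_iff]
    intro g h
    refine hg g (hzero _ ?_ ?_ ?_ ?_ ?_ ?_)
    · simpa [M, Matrix.row, Fin.sum_univ_four] using congrFun h 0
    · simpa [M, Matrix.row, Fin.sum_univ_four] using congrFun h 1
    · simpa [M, Matrix.row, Fin.sum_univ_four] using congrFun h 2
    · simpa [M, Matrix.row, Fin.sum_univ_four] using congrFun h 3
    · simpa [M, Matrix.row, Fin.sum_univ_four] using congrFun h 4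
    · simpa [M, Matrix.row, Fin.sum_univ_four] using congrFun h 5
  have hN : LinearIndependent ℝ N.row := by
    rw [Fintype.linearIndependent_iff]
    intro g h
    have h1 := congrFun h 1
    have h4 := congrFun h 4
    simp [N, Matrix.row, Fin.sum_univ_four] at h1 h4
    refine hg g (hzero _ ?_ ?_ ?_ ?_ ?_ ?_)
    · simpa [N, Matrix.row, Fin.sum_univ_four] using congrFun h 5
    · simp [Fin.sum_univ_four]; linarith
    · simpa [N, Matrix.row, Fin.sum_univ_four] using congrFun h 3
    · simpa [N, Matrix.row, Fin.sum_univ_four] using congrFun h 2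
    · simp [Fin.sum_univ_four]; linarith
    · simpa [N, Matrix.row, Fin.sum_univ_four] using congrFun h 0
  have hMN : M * N.transpose = 0 := by
    ext k l
    have := wedge_exact b (b.coord k) (b.coord l)
    rw [hT] at this
    simp only [LinearMap.zero_apply, mul_zero, sub_zero, add_zero] at this
    rw [Matrix.mul_apply, Fin.sum_univ_six, Matrix.zero_apply]
    simp only [Matrix.transpose_apply, Matrix.of_apply, M, N]
    simp only [Matrix.cons_val]
    linear_combination this
  have h := Matrix.rank_add_rank_le_card_of_mul_eq_zero hMN
  rw [Matrix.rank_transpose, hM.rank_matrix, hN.rank_matrix] at h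
  simp at h

end Closed

/-! ### Low-degree cohomology, and the components of a three-form on a product -/

section Cohomology
variable {L : Type*} [LieRing L] [LieAlgebra ℝ L]

theorem finite_forms [FiniteDimensional ℝ L] (k : ℕ) : Module.Finite ℝ (L [⋀^Fin k]→ₗ[ℝ] ℝ) := by
  have e : (L [⋀^Fin k]→ₗ[ℝ] ℝ) ≃ₗ[ℝ] Dual ℝ (⋀[ℝ]^k L) :=
    exteriorPower.alternatingMapLinearEquiv
  exact Module.Finite.equiv e.symm

theorem cocycles_le_coboundaries [FiniteDimensional ℝ L] {k : ℕ} (hk : h L k = 0) :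
    cocycles L k ≤ coboundaries L k := by
  have := finite_forms (L := L) k
  have h0 : cohomology L k = ⊥ := Submodule.finrank_eq_zero.1 hk
  rw [cohomology, ← LinearMap.le_ker_iff_map, Submodule.ker_mkQ] at h0
  exact h0

/-- If `H²` vanishes, closed two-forms are exact. -/
theorem exists_primitive [FiniteDimensional ℝ L] (h2 : h L 2 = 0) (ω : L [⋀^Fin 2]→ₗ[ℝ] ℝ)
    (hω : d L 2 ω = 0) : ∃ η : Dual ℝ L, ∀ x y, ω ![x, y] = -η ⁅x, y⁆ := by
  obtain ⟨α, rfl⟩ := cocycles_le_coboundaries h2 (x := ω) hω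
  have h1 : ∀ z, (AlternatingMap.ofSubsingleton ℝ L ℝ (0 : Fin 1)).symm α z = α ![z] := fun z =>
    congrArg α (funext fun i => by fin_cases i; rfl)
  exact ⟨(AlternatingMap.ofSubsingleton ℝ L ℝ (0 : Fin 1)).symm α, fun x y => by
    rw [d_one_apply, h1]⟩

/-- If `H⁴` vanishes, a four-dimensional Lie algebra is not unimodular. -/
theorem adTrace_ne_zero (hL : finrank ℝ L = 4) (h4 : h L 4 = 0) : adTrace L ≠ 0 := by
  intro hT
  have : FiniteDimensional ℝ L := FiniteDimensional.of_finrank_pos (by omega)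
  let b := finBasisOfFinrankEq ℝ L hL
  have hcl : d L 4 b.det = 0 := by
    ext v
    refine AlternatingMap.map_linearDependent _ v fun hv => ?_
    have := hv.fintype_card_le_finrank
    rw [hL] at this
    simp at this
  obtain ⟨η, hη⟩ := cocycles_le_coboundaries h4 (x := b.det) hcl
  have h1 : d L 3 η b = 1 := by rw [hη, b.det_self]
  have hb : (b : Fin 4 → L) = ![b 0, b 1, b 2, b 3] := by
    ext i
    fin_cases i <;> rfl
  rw [hb, d_three_basis b η, hT] at h1
  simp at h1

/-- If `H¹` is one-dimensional, two closed linear forms are proportional. -/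
theorem exists_smul_of_closed (h1 : h L 1 = 1) (τ σ : Dual ℝ L)
    (hτ0 : τ ≠ 0) (hτ : ∀ x y : L, τ ⁅x, y⁆ = 0) (hσ : ∀ x y : L, σ ⁅x, y⁆ = 0) :
    ∃ r : ℝ, σ = r • τ := by
  let F : Dual ℝ L → L [⋀^Fin 1]→ₗ[ℝ] ℝ := AlternatingMap.ofSubsingleton ℝ L ℝ (0 : Fin 1)
  have hF : ∀ σ : Dual ℝ L, (∀ x y : L, σ ⁅x, y⁆ = 0) → F σ ∈ cocycles L 1 := by
    intro σ hσ
    refine LinearMap.mem_ker.2 (AlternatingMap.ext fun v => ?_)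
    have hv : v = ![v 0, v 1] := by
      ext i
      fin_cases i <;> rfl
    rw [hv, d_one_apply]
    simp [F, hσ]
  have hB : coboundaries L 1 = ⊥ := LinearMap.range_zero
  have hinj : Function.Injective (coboundaries L 1).mkQ := by
    rw [← LinearMap.ker_eq_bot, Submodule.ker_mkQ, hB]
  let G : ∀ σ : Dual ℝ L, (∀ x y : L, σ ⁅x, y⁆ = 0) → cohomology L 1 :=
    fun σ hσ => ⟨(coboundaries L 1).mkQ (F σ), Submodule.mem_map_of_mem (hF σ hσ)⟩
  have hG : G τ hτ ≠ 0 := by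
    intro h
    have h' : (coboundaries L 1).mkQ (F τ) = 0 := congrArg Subtype.val h
    rw [← map_zero (coboundaries L 1).mkQ] at h'
    apply hτ0
    ext x
    simpa [F] using congrArg (fun α : L [⋀^Fin 1]→ₗ[ℝ] ℝ => α ![x]) (hinj h')
  obtain ⟨r, hr⟩ := (finrank_eq_one_iff_of_nonzero' _ hG).1 h1 (G σ hσ)
  refine ⟨r, ?_⟩
  have h' : r • (coboundaries L 1).mkQ (F τ) = (coboundaries L 1).mkQ (F σ) :=
    congrArg Subtype.val hr
  rw [← map_smul] at h'
  ext x
  simpa [F] using congrArg (fun α : L [⋀^Fin 1]→ₗ[ℝ] ℝ => α ![x]) (hinj h').symm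

end Cohomology

section TwoForms
variable {V : Type*} [AddCommGroup V] [Module ℝ V]

/-- An alternating two-form as a bilinear form. -/
def toBilin (ω : V [⋀^Fin 2]→ₗ[ℝ] ℝ) : LinearMap.BilinForm ℝ V :=
  LinearMap.mk₂ ℝ (fun x y => AlternatingMap.curryLeft ω x ![y])
    (fun x x' y => by simp) (fun c x y => by simp)
    (fun x y y' => by
      have h : ∀ z : V, AlternatingMap.curryLeft ω x ![z]
          = AlternatingMap.curryLeft (AlternatingMap.curryLeft ω x) z ![] := fun _ => rfl
      simp only [h, map_add, AlternatingMap.add_apply])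
    (fun c x y => by
      have h : ∀ z : V, AlternatingMap.curryLeft ω x ![z]
          = AlternatingMap.curryLeft (AlternatingMap.curryLeft ω x) z ![] := fun _ => rfl
      simp only [h, map_smul, AlternatingMap.smul_apply])

theorem toBilin_apply (ω : V [⋀^Fin 2]→ₗ[ℝ] ℝ) (x y : V) : toBilin ω x y = ω ![x, y] := rfl

theorem toBilin_isAlt (ω : V [⋀^Fin 2]→ₗ[ℝ] ℝ) : (toBilin ω).IsAlt := fun x =>
  ω.map_eq_zero_of_eq ![x, x] (i := 0) (j := 1) rfl (by decide)

theorem isClosedForm_toBilin {L : Type*} [LieRing L] [LieAlgebra ℝ L] (ω : L [⋀^Fin 2]→ₗ[ℝ] ℝ)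
    (hω : d L 2 ω = 0) : IsClosedForm (toBilin ω) := by
  intro x y z
  have := d_two_apply ω x y z
  rw [hω] at this
  rw [← lie_skew z x, map_neg, LinearMap.neg_apply]
  simp only [toBilin_apply]
  simp at this
  linarith

end TwoForms

section Product
variable {g₄ g₂ : Type*} [LieRing g₄] [LieAlgebra ℝ g₄] [LieRing g₂] [LieAlgebra ℝ g₂]

/-- The component in `Λ³g₄*` of a three-form on `g₄ × g₂`. -/
def base (ρ : (g₄ × g₂) [⋀^Fin 3]→ₗ[ℝ] ℝ) : g₄ [⋀^Fin 3]→ₗ[ℝ] ℝ :=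
  ρ.compLinearMap (LinearMap.inl ℝ g₄ g₂)

/-- The two-form `f ⌟ ρ` on `g₄` for `f ∈ g₂`. -/
def slice (ρ : (g₄ × g₂) [⋀^Fin 3]→ₗ[ℝ] ℝ) (f : g₂) : g₄ [⋀^Fin 2]→ₗ[ℝ] ℝ :=
  (AlternatingMap.curryLeft ρ (0, f)).compLinearMap (LinearMap.inl ℝ g₄ g₂)

/-- The linear form `x ↦ ρ (x, f, f')` on `g₄` for `f, f' ∈ g₂`. -/
def mixed (ρ : (g₄ × g₂) [⋀^Fin 3]→ₗ[ℝ] ℝ) (f f' : g₂) : Dual ℝ g₄ where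
  toFun x := toBilin (AlternatingMap.curryLeft ρ (x, 0)) (0, f) (0, f')
  map_add' x y := by
    rw [← add_zero (0 : g₂), ← Prod.mk_add_mk, map_add]
    simp [toBilin_apply]
  map_smul' c x := by
    rw [← smul_zero c, ← Prod.smul_mk, map_smul]
    simp [toBilin_apply]

variable (ρ : (g₄ × g₂) [⋀^Fin 3]→ₗ[ℝ] ℝ)

theorem base_apply (x y z : g₄) : base ρ ![x, y, z] = ρ ![(x, 0), (y, 0), (z, 0)] := by
  rw [base, AlternatingMap.compLinearMap_apply]
  congr 1
  ext i <;> fin_cases i <;> rfl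

theorem slice_apply (f : g₂) (x y : g₄) : slice ρ f ![x, y] = ρ ![(x, 0), (y, 0), (0, f)] := by
  rw [three_form_swap_right, three_form_swap_left, neg_neg, slice,
    AlternatingMap.compLinearMap_apply, AlternatingMap.curryLeft_apply_apply]
  congr 1
  ext i <;> fin_cases i <;> rfl

theorem mixed_apply (f f' : g₂) (x : g₄) : mixed ρ f f' x = ρ ![(x, 0), (0, f), (0, f')] := rfl

theorem slice_comb (p q : ℝ) (f f' : g₂) (v : Fin 2 → g₄) :
    slice ρ (p • f + q • f') v = p * slice ρ f v + q * slice ρ f' v := by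
  have : ((0, p • f + q • f') : g₄ × g₂) = p • (0, f) + q • (0, f') := by simp
  rw [slice, this, map_add, map_smul, map_smul]
  rfl

/-- Up to a scalar, the mixed component is independent of the basis of the plane `g₂`. -/
theorem mixed_comb (p q : ℝ) (f f' : g₂) :
    mixed ρ (p • f + q • f') (-q • f + p • f') = (p ^ 2 + q ^ 2) • mixed ρ f f' := by
  ext x
  set ω := toBilin (AlternatingMap.curryLeft ρ (x, 0)) with hω
  have hm : ∀ u v, mixed ρ u v x = ω (0, u) (0, v) := fun _ _ => rfl
  have h : ∀ a b : ℝ, ((0, a • f + b • f') : g₄ × g₂) = a • (0, f) + b • (0, f') := by simp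
  have hA : ω.IsAlt := toBilin_isAlt _
  have hs := hA.neg_eq (0, f) (0, f')
  simp only [LinearMap.smul_apply, hm, h, map_add, map_smul, LinearMap.add_apply, smul_eq_mul,
    hA (0, f), hA (0, f'), ← hs]
  ring

/-- The base component of a closed three-form is closed; see `d_three_basis`. -/
theorem adTrace_base (hρ : d (g₄ × g₂) 3 ρ = 0) (b : Basis (Fin 4) ℝ g₄) :
    -adTrace g₄ (b 0) * base ρ ![b 1, b 2, b 3] + adTrace g₄ (b 1) * base ρ ![b 0, b 2, b 3]
      - adTrace g₄ (b 2) * base ρ ![b 0, b 1, b 3] + adTrace g₄ (b 3) * base ρ ![b 0, b 1, b 2]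
      = 0 := by
  rw [← d_three_basis]
  have := d_three_apply ρ (b 0, 0) (b 1, 0) (b 2, 0) (b 3, 0)
  rw [hρ] at this
  simp only [LieAlgebra.Prod.bracket_apply, lie_zero] at this
  rw [d_three_apply]
  simp only [base_apply]
  simpa using this.symm

/-- The slices of a closed three-form are closed, whatever the bracket of `g₂`. -/
theorem d_slice (hρ : d (g₄ × g₂) 3 ρ = 0) (f : g₂) : d g₄ 2 (slice ρ f) = 0 := by
  ext v
  have hv : v = ![v 0, v 1, v 2] := by
    ext i
    fin_cases i <;> rfl
  have := d_three_apply ρ (v 0, 0) (v 1, 0) (v 2, 0) (0, f)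
  rw [hρ] at this
  have h0 : ∀ y z, ρ ![(0, 0), y, z] = 0 := fun y z => ρ.map_coord_zero 0 rfl
  simp only [LieAlgebra.Prod.bracket_apply, lie_zero, zero_lie, h0] at this
  rw [hv, d_two_apply]
  simp only [slice_apply]
  simp at this ⊢
  linarith

/-- If `g₂` is abelian, the mixed component of a closed three-form is closed. -/
theorem mixed_lie [IsLieAbelian g₂] (hρ : d (g₄ × g₂) 3 ρ = 0) (f f' : g₂) (x y : g₄) :
    mixed ρ f f' ⁅x, y⁆ = 0 := by
  have := d_three_apply ρ (x, 0) (y, 0) (0, f) (0, f')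
  rw [hρ] at this
  have h0 : ∀ y z, ρ ![(0, 0), y, z] = 0 := fun y z => ρ.map_coord_zero 0 rfl
  simp only [LieAlgebra.Prod.bracket_apply, lie_zero, trivial_lie_zero, h0] at this
  rw [mixed_apply]
  simp at this
  exact this

end Product

/-! ### The quartic invariant on a product -/

section Product
variable {g₄ g₂ : Type*} [LieRing g₄] [LieAlgebra ℝ g₄] [LieRing g₂] [LieAlgebra ℝ g₂]

/-- The basis of `g₄ × g₂` obtained from bases of the factors. -/
def prodBasis (b : Basis (Fin 4) ℝ g₄) (c : Basis (Fin 2) ℝ g₂) : Basis (Fin 6) ℝ (g₄ × g₂) :=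
  (b.prod c).reindex finSumFinEquiv

/-- `quarticInvariant_eq` in terms of the components of a three-form on `g₄ × g₂`. -/
theorem quarticInvariant_prod (b : Basis (Fin 4) ℝ g₄) (c : Basis (Fin 2) ℝ g₂)
    (ν : (g₄ × g₂) [⋀^Fin 6]→ₗ[ℝ] ℝ) (hν : ν ≠ 0) (ρ : (g₄ × g₂) [⋀^Fin 3]→ₗ[ℝ] ℝ)
    {g012 g013 p01 p02 p03 g023 p12 p13 p23 a0 q01 q02 q03 g123 a1 q12 q13 a2 q23 a3 : ℝ}
    (h012 : base ρ ![b 0, b 1, b 2] = g012) (h013 : base ρ ![b 0, b 1, b 3] = g013)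
    (h023 : base ρ ![b 0, b 2, b 3] = g023) (h123 : base ρ ![b 1, b 2, b 3] = g123)
    (hp01 : slice ρ (c 0) ![b 0, b 1] = p01) (hp02 : slice ρ (c 0) ![b 0, b 2] = p02)
    (hp03 : slice ρ (c 0) ![b 0, b 3] = p03) (hp12 : slice ρ (c 0) ![b 1, b 2] = p12)
    (hp13 : slice ρ (c 0) ![b 1, b 3] = p13) (hp23 : slice ρ (c 0) ![b 2, b 3] = p23)
    (hq01 : slice ρ (c 1) ![b 0, b 1] = q01) (hq02 : slice ρ (c 1) ![b 0, b 2] = q02)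
    (hq03 : slice ρ (c 1) ![b 0, b 3] = q03) (hq12 : slice ρ (c 1) ![b 1, b 2] = q12)
    (hq13 : slice ρ (c 1) ![b 1, b 3] = q13) (hq23 : slice ρ (c 1) ![b 2, b 3] = q23)
    (ha0 : mixed ρ (c 0) (c 1) (b 0) = a0) (ha1 : mixed ρ (c 0) (c 1) (b 1) = a1)
    (ha2 : mixed ρ (c 0) (c 1) (b 2) = a2) (ha3 : mixed ρ (c 0) (c 1) (b 3) = a3) :
    quarticInvariant ν ρ * ν (prodBasis b c) ^ 2 =
      (a0 * g123 - a1 * g023 + a2 * g013 - a3 * g012) ^ 2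
      + 2 * (a0 * g012 * (2 * p13 * q23 - 2 * p23 * q13)
         + a0 * g013 * (-2 * p12 * q23 + 2 * p23 * q12)
         + a0 * g023 * (2 * p12 * q13 - 2 * p13 * q12)
         + a0 * g123 * (p01 * q23 - p02 * q13 + p03 * q12 - p12 * q03 + p13 * q02 - p23 * q01)
         + a1 * g012 * (-2 * p03 * q23 + 2 * p23 * q03)
         + a1 * g013 * (2 * p02 * q23 - 2 * p23 * q02)
         + a1 * g023 * (-p01 * q23 - p02 * q13 + p03 * q12 - p12 * q03 + p13 * q02 + p23 * q01)
         + a1 * g123 * (2 * p02 * q03 - 2 * p03 * q02)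
         + a2 * g012 * (2 * p03 * q13 - 2 * p13 * q03)
         + a2 * g013 * (-p01 * q23 - p02 * q13 - p03 * q12 + p12 * q03 + p13 * q02 + p23 * q01)
         + a2 * g023 * (2 * p01 * q13 - 2 * p13 * q01)
         + a2 * g123 * (-2 * p01 * q03 + 2 * p03 * q01)
         + a3 * g012 * (p01 * q23 - p02 * q13 - p03 * q12 + p12 * q03 + p13 * q02 - p23 * q01)
         + a3 * g013 * (2 * p02 * q12 - 2 * p12 * q02)
         + a3 * g023 * (-2 * p01 * q12 + 2 * p12 * q01)
         + a3 * g123 * (2 * p01 * q02 - 2 * p02 * q01))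
      + (p01 * q23 - p02 * q13 + p03 * q12 + p12 * q03 - p13 * q02 + p23 * q01) ^ 2
      - 4 * (p01 * p23 - p02 * p13 + p03 * p12) * (q01 * q23 - q02 * q13 + q03 * q12) := by
  have b0 : prodBasis b c 0 = (b 0, 0) := by simp [prodBasis, finSumFinEquiv, Fin.addCases]
  have b1 : prodBasis b c 1 = (b 1, 0) := by simp [prodBasis, finSumFinEquiv, Fin.addCases]
  have b2 : prodBasis b c 2 = (b 2, 0) := by simp [prodBasis, finSumFinEquiv, Fin.addCases]
  have b3 : prodBasis b c 3 = (b 3, 0) := by simp [prodBasis, finSumFinEquiv, Fin.addCases]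
  have b4 : prodBasis b c 4 = (0, c 0) := by simp [prodBasis, finSumFinEquiv, Fin.addCases]
  have b5 : prodBasis b c 5 = (0, c 1) := by simp [prodBasis, finSumFinEquiv, Fin.addCases]
  rw [base_apply] at h012 h013 h023 h123
  rw [slice_apply] at hp01 hp02 hp03 hp12 hp13 hp23 hq01 hq02 hq03 hq12 hq13 hq23
  rw [mixed_apply] at ha0 ha1 ha2 ha3
  exact quarticInvariant_eq (prodBasis b c) ν hν ρ
    (by rw [b0, b1, b2]; exact h012) (by rw [b0, b1, b3]; exact h013)
    (by rw [b0, b1, b4]; exact hp01) (by rw [b0, b1, b5]; exact hq01)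
    (by rw [b0, b2, b3]; exact h023) (by rw [b0, b2, b4]; exact hp02)
    (by rw [b0, b2, b5]; exact hq02) (by rw [b0, b3, b4]; exact hp03)
    (by rw [b0, b3, b5]; exact hq03) (by rw [b0, b4, b5]; exact ha0)
    (by rw [b1, b2, b3]; exact h123) (by rw [b1, b2, b4]; exact hp12)
    (by rw [b1, b2, b5]; exact hq12) (by rw [b1, b3, b4]; exact hp13)
    (by rw [b1, b3, b5]; exact hq13) (by rw [b1, b4, b5]; exact ha1)
    (by rw [b2, b3, b4]; exact hp23) (by rw [b2, b3, b5]; exact hq23)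
    (by rw [b2, b4, b5]; exact ha2) (by rw [b3, b4, b5]; exact ha3)

theorem sq_map_prodBasis_pos (b : Basis (Fin 4) ℝ g₄) (c : Basis (Fin 2) ℝ g₂)
    (ν : (g₄ × g₂) [⋀^Fin 6]→ₗ[ℝ] ℝ) (hν : ν ≠ 0) : 0 < ν (prodBasis b c) ^ 2 := by
  have := (AlternatingMap.map_basis_ne_zero_iff (prodBasis b c) ν).2 hν
  positivity

/-- If the mixed component and one slice of `ρ` vanish on the span of `b 0, b 1, b 2`, then `λ(ρ)`
is a square. -/
theorem quarticInvariant_nonneg_of_slice (b : Basis (Fin 4) ℝ g₄) (c : Basis (Fin 2) ℝ g₂)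
    (ν : (g₄ × g₂) [⋀^Fin 6]→ₗ[ℝ] ℝ) (hν : ν ≠ 0) (ρ : (g₄ × g₂) [⋀^Fin 3]→ₗ[ℝ] ℝ)
    (ha0 : mixed ρ (c 0) (c 1) (b 0) = 0) (ha1 : mixed ρ (c 0) (c 1) (b 1) = 0)
    (ha2 : mixed ρ (c 0) (c 1) (b 2) = 0) (hp01 : slice ρ (c 0) ![b 0, b 1] = 0)
    (hp02 : slice ρ (c 0) ![b 0, b 2] = 0) (hp12 : slice ρ (c 0) ![b 1, b 2] = 0) :
    0 ≤ quarticInvariant ν ρ := by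
  have h := quarticInvariant_prod b c ν hν ρ rfl rfl rfl rfl hp01 hp02 rfl hp12 rfl rfl rfl rfl rfl
    rfl rfl rfl ha0 ha1 ha2 rfl
  refine nonneg_of_mul_nonneg_left ?_ (sq_map_prodBasis_pos b c ν hν)
  rw [h]
  refine le_of_le_of_eq (sq_nonneg (mixed ρ (c 0) (c 1) (b 3) * base ρ ![b 0, b 1, b 2]
    - slice ρ (c 0) ![b 0, b 3] * slice ρ (c 1) ![b 1, b 2]
    + slice ρ (c 0) ![b 1, b 3] * slice ρ (c 1) ![b 0, b 2]
    - slice ρ (c 0) ![b 2, b 3] * slice ρ (c 1) ![b 0, b 1])) ?_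
  ring

/-- If the mixed component is a multiple of `b.coord 2`, one slice and the base component of `ρ`
vanish on the span of `b 0, b 1, b 2`, and the other slice vanishes on that of `b 0, b 1`, then
`λ(ρ)` is a square. -/
theorem quarticInvariant_nonneg_of_coord (b : Basis (Fin 4) ℝ g₄) (c : Basis (Fin 2) ℝ g₂)
    (ν : (g₄ × g₂) [⋀^Fin 6]→ₗ[ℝ] ℝ) (hν : ν ≠ 0) (ρ : (g₄ × g₂) [⋀^Fin 3]→ₗ[ℝ] ℝ)
    (ha0 : mixed ρ (c 0) (c 1) (b 0) = 0) (ha1 : mixed ρ (c 0) (c 1) (b 1) = 0)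
    (ha3 : mixed ρ (c 0) (c 1) (b 3) = 0) (hp01 : slice ρ (c 0) ![b 0, b 1] = 0)
    (hp02 : slice ρ (c 0) ![b 0, b 2] = 0) (hp12 : slice ρ (c 0) ![b 1, b 2] = 0)
    (hq01 : slice ρ (c 1) ![b 0, b 1] = 0) (h012 : base ρ ![b 0, b 1, b 2] = 0) :
    0 ≤ quarticInvariant ν ρ := by
  have h := quarticInvariant_prod b c ν hν ρ h012 rfl rfl rfl hp01 hp02 rfl hp12 rfl rfl hq01 rfl
    rfl rfl rfl rfl ha0 ha1 rfl ha3
  refine nonneg_of_mul_nonneg_left ?_ (sq_map_prodBasis_pos b c ν hν)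
  rw [h]
  refine le_of_le_of_eq (sq_nonneg (mixed ρ (c 0) (c 1) (b 2) * base ρ ![b 0, b 1, b 3]
    - slice ρ (c 0) ![b 0, b 3] * slice ρ (c 1) ![b 1, b 2]
    + slice ρ (c 0) ![b 1, b 3] * slice ρ (c 1) ![b 0, b 2])) ?_
  ring

/-- If the slices and the base component of `ρ` vanish on the span of `b 0, b 1, b 2`, then `λ(ρ)`
is a square. -/
theorem quarticInvariant_nonneg_of_slices (b : Basis (Fin 4) ℝ g₄) (c : Basis (Fin 2) ℝ g₂)
    (ν : (g₄ × g₂) [⋀^Fin 6]→ₗ[ℝ] ℝ) (hν : ν ≠ 0) (ρ : (g₄ × g₂) [⋀^Fin 3]→ₗ[ℝ] ℝ)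
    (h012 : base ρ ![b 0, b 1, b 2] = 0)
    (hp01 : slice ρ (c 0) ![b 0, b 1] = 0) (hp02 : slice ρ (c 0) ![b 0, b 2] = 0)
    (hp12 : slice ρ (c 0) ![b 1, b 2] = 0) (hq01 : slice ρ (c 1) ![b 0, b 1] = 0)
    (hq02 : slice ρ (c 1) ![b 0, b 2] = 0) (hq12 : slice ρ (c 1) ![b 1, b 2] = 0) :
    0 ≤ quarticInvariant ν ρ := by
  have h := quarticInvariant_prod b c ν hν ρ h012 rfl rfl rfl hp01 hp02 rfl hp12 rfl rfl hq01 hq02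
    rfl hq12 rfl rfl rfl rfl rfl rfl
  refine nonneg_of_mul_nonneg_left ?_ (sq_map_prodBasis_pos b c ν hν)
  rw [h]
  refine le_of_le_of_eq (sq_nonneg (mixed ρ (c 0) (c 1) (b 0) * base ρ ![b 1, b 2, b 3]
    - mixed ρ (c 0) (c 1) (b 1) * base ρ ![b 0, b 2, b 3]
    + mixed ρ (c 0) (c 1) (b 2) * base ρ ![b 0, b 1, b 3])) ?_
  ring

/-- If the mixed and the base component of `ρ` vanish on the span of `b 0, b 1, b 2`, and the slices
on `b 0, b 1`, then `λ(ρ)` is, up to a multiple of a minor of the slices, the discriminant of the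
quadratic form `f ↦ slice ρ f ∧ slice ρ f` on `g₂`. -/
theorem quarticInvariant_eq_zero (b : Basis (Fin 4) ℝ g₄) (c : Basis (Fin 2) ℝ g₂)
    (ν : (g₄ × g₂) [⋀^Fin 6]→ₗ[ℝ] ℝ) (hν : ν ≠ 0) (ρ : (g₄ × g₂) [⋀^Fin 3]→ₗ[ℝ] ℝ)
    (ha0 : mixed ρ (c 0) (c 1) (b 0) = 0) (ha1 : mixed ρ (c 0) (c 1) (b 1) = 0)
    (ha2 : mixed ρ (c 0) (c 1) (b 2) = 0) (h012 : base ρ ![b 0, b 1, b 2] = 0)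
    (hp01 : slice ρ (c 0) ![b 0, b 1] = 0) (hq01 : slice ρ (c 1) ![b 0, b 1] = 0)
    (hpq : slice ρ (c 0) ![b 0, b 2] * slice ρ (c 1) ![b 1, b 2]
      = slice ρ (c 0) ![b 1, b 2] * slice ρ (c 1) ![b 0, b 2])
    (hdisc : (slice ρ (c 0) ![b 0, b 3] * slice ρ (c 1) ![b 1, b 2]
        - slice ρ (c 0) ![b 0, b 2] * slice ρ (c 1) ![b 1, b 3]
        + slice ρ (c 0) ![b 1, b 2] * slice ρ (c 1) ![b 0, b 3]
        - slice ρ (c 0) ![b 1, b 3] * slice ρ (c 1) ![b 0, b 2]) ^ 2 =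
      4 * (slice ρ (c 0) ![b 0, b 3] * slice ρ (c 0) ![b 1, b 2]
        - slice ρ (c 0) ![b 0, b 2] * slice ρ (c 0) ![b 1, b 3])
      * (slice ρ (c 1) ![b 0, b 3] * slice ρ (c 1) ![b 1, b 2]
        - slice ρ (c 1) ![b 0, b 2] * slice ρ (c 1) ![b 1, b 3])) :
    quarticInvariant ν ρ = 0 := by
  have h := quarticInvariant_prod b c ν hν ρ h012 rfl rfl rfl hp01 rfl rfl rfl rfl rfl hq01 rfl
    rfl rfl rfl rfl ha0 ha1 ha2 rfl
  refine (mul_eq_zero.1 (?_ : quarticInvariant ν ρ * ν (prodBasis b c) ^ 2 = 0)).resolve_right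
    (sq_map_prodBasis_pos b c ν hν).ne'
  rw [h]
  linear_combination hdisc
    + 4 * mixed ρ (c 0) (c 1) (b 3) * base ρ ![b 0, b 1, b 3] * hpq

end Product

/-! ### Vanishing of the quartic invariant -/

section Nonunimodular
variable {L : Type*} [LieRing L] [LieAlgebra ℝ L]

/-- If `H¹` is spanned by the trace form, the endomorphism induced by `f 2` on the plane spanned by
`f 0` and `f 1` is nilpotent: otherwise the second coordinate would be closed as well. -/
theorem sq_add_mul_eq_zero (h1 : h L 1 = 1) (f : Basis (Fin 4) ℝ L)
    (hf : ∀ x y : L, f.coord 3 ⁅x, y⁆ = 0) {a c d : ℝ} (h01 : ⁅f 0, f 1⁆ = 0)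
    (h20 : ⁅f 2, f 0⁆ = a • f 0 + c • f 1) (h21 : ⁅f 2, f 1⁆ = d • f 0 + -a • f 1) :
    a ^ 2 + c * d = 0 := by
  by_contra hδ
  obtain ⟨u0, u1, u2, h30⟩ := exists_coeff f (f.coord 3) (by simp) (by simp) (by simp) (by simp) _
    (hf (f 3) (f 0))
  obtain ⟨v0, v1, v2, h31⟩ := exists_coeff f (f.coord 3) (by simp) (by simp) (by simp) (by simp) _
    (hf (f 3) (f 1))
  obtain ⟨w0, w1, w2, h32⟩ := exists_coeff f (f.coord 3) (by simp) (by simp) (by simp) (by simp) _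
    (hf (f 3) (f 2))
  have h10 : ⁅f 1, f 0⁆ = 0 := by rw [← lie_skew, h01, neg_zero]
  have h02 : ⁅f 0, f 2⁆ = -(a • f 0 + c • f 1) := by rw [← lie_skew, h20]
  have J1 := leibniz_lie (f 3) (f 0) (f 1)
  have J2 := leibniz_lie (f 3) (f 2) (f 0)
  have J3 := leibniz_lie (f 3) (f 2) (f 1)
  simp only [h30, h31, h32, h20, h21, h01, h10, h02, lie_add, add_lie, lie_smul, smul_lie, lie_zero,
    lie_self] at J1 J2 J3
  have k10 := congrArg (f.coord 0) J1
  have k11 := congrArg (f.coord 1) J1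
  have k20 := congrArg (f.coord 0) J2
  have k21 := congrArg (f.coord 1) J2
  have k30 := congrArg (f.coord 0) J3
  have k31 := congrArg (f.coord 1) J3
  simp at k10 k11 k20 k21 k30 k31
  have hu : u2 = 0 := by
    refine (mul_eq_zero.1 (?_ : u2 * (a ^ 2 + c * d) = 0)).resolve_right hδ
    linear_combination -c * k10 + a * k11
  have hv : v2 = 0 := by
    refine (mul_eq_zero.1 (?_ : v2 * (a ^ 2 + c * d) = 0)).resolve_right hδ
    linear_combination a * k10 + d * k11
  have hw : w2 = 0 := by
    refine (mul_eq_zero.1 (?_ : w2 * (a ^ 2 + c * d) = 0)).resolve_right hδ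
    subst hu hv
    linear_combination (-1 / 2) * (a * k20 + d * k21 + c * k30 - a * k31)
  have hcl : ∀ x y : L, f.coord 2 ⁅x, y⁆ = 0 := by
    intro x y
    rw [lie_eq_sum_e f, h30, h31, h32, h20, h21, h01, hu, hv, hw]
    simp
  obtain ⟨r, hr⟩ := exists_smul_of_closed h1 (f.coord 3) (f.coord 2)
    (fun h => by simpa using LinearMap.congr_fun h (f 3)) hf hcl
  simpa using LinearMap.congr_fun hr (f 2)

end Nonunimodular

section Product
variable {g₄ g₂ : Type*} [LieRing g₄] [LieAlgebra ℝ g₄] [LieRing g₂] [LieAlgebra ℝ g₂]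

/-- The base component of a closed three-form vanishes on the kernel of the trace form. -/
theorem base_eq_zero (ρ : (g₄ × g₂) [⋀^Fin 3]→ₗ[ℝ] ℝ) (hρ : d (g₄ × g₂) 3 ρ = 0)
    (b : Basis (Fin 4) ℝ g₄) (hb : b.coord 3 = adTrace g₄) : base ρ ![b 0, b 1, b 2] = 0 := by
  have := adTrace_base ρ hρ b
  rw [← hb] at this
  simpa using this

/-- In an adapted basis, `[f 0, f 1] = 0` and `f 2` acts nilpotently on the plane of `f 0, f 1`.
The slices are `dη` and `dθ`, and by `wedge_exact` their wedge products are the values on `η, θ` of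
a quadratic form in the restrictions to that plane, whose determinant is that of the nilpotent
endomorphism. -/
theorem quarticInvariant_eq_zero_of_abelian [IsLieAbelian g₂] (c : Basis (Fin 2) ℝ g₂)
    (hL : finrank ℝ g₄ = 4) (h1 : h g₄ 1 = 1) (h2 : h g₄ 2 = 0) (h4 : h g₄ 4 = 0)
    (ν : (g₄ × g₂) [⋀^Fin 6]→ₗ[ℝ] ℝ) (hν : ν ≠ 0) (ρ : (g₄ × g₂) [⋀^Fin 3]→ₗ[ℝ] ℝ)
    (hρ : d (g₄ × g₂) 3 ρ = 0) : quarticInvariant ν ρ = 0 := by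
  have : FiniteDimensional ℝ g₄ := FiniteDimensional.of_finrank_pos (by omega)
  have hT0 := adTrace_ne_zero hL h4
  obtain ⟨f, a, c', d', hf, h01, h20, h21⟩ := exists_adapted_basis hL (adTrace g₄) hT0
    adTrace_lie (fun _ h => h) (Or.inl hT0)
  have hδ := sq_add_mul_eq_zero h1 f (by rw [hf]; exact adTrace_lie) h01 h20 h21
  obtain ⟨r, hr⟩ := exists_smul_of_closed h1 (adTrace g₄) (mixed ρ (c 0) (c 1)) hT0 adTrace_lie
    (mixed_lie ρ hρ _ _)
  obtain ⟨η, hη⟩ := exists_primitive h2 _ (d_slice ρ hρ (c 0))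
  obtain ⟨θ, hθ⟩ := exists_primitive h2 _ (d_slice ρ hρ (c 1))
  have h02 : ⁅f 0, f 2⁆ = -(a • f 0 + c' • f 1) := by rw [← lie_skew, h20]
  have h12 : ⁅f 1, f 2⁆ = -(d' • f 0 + -a • f 1) := by rw [← lie_skew, h21]
  have W1 := wedge_exact f η η
  have W2 := wedge_exact f η θ
  have W3 := wedge_exact f θ θ
  rw [← hf] at W1 W2 W3
  simp only [h01, h02, h12, Basis.coord_apply, Basis.repr_self] at W1 W2 W3
  simp at W1 W2 W3
  rw [← hf] at hr
  refine quarticInvariant_eq_zero f c ν hν ρ (by rw [hr]; simp) (by rw [hr]; simp)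
    (by rw [hr]; simp) (base_eq_zero ρ hρ f hf) (by rw [hη, h01]; simp) (by rw [hθ, h01]; simp)
    ?_ ?_
  · rw [hη, hη, hθ, hθ, h02, h12]
    simp
    linear_combination (η (f 1) * θ (f 0) - η (f 0) * θ (f 1)) * hδ
  · simp only [hη, hθ, h02, h12]
    simp
    have E2 := congrArg (· ^ 2) W2
    have E13 := congrArg₂ (· * ·) W1 W3
    beta_reduce at E2 E13
    linear_combination E2 - E13 + (η (f 0) * θ (f 1) - η (f 1) * θ (f 0)) ^ 2 * hδ

end Product

/-! ### Sign of the quartic invariant -/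

section Product
variable {g₄ g₂ : Type*} [LieRing g₄] [LieAlgebra ℝ g₄] [LieRing g₂] [LieAlgebra ℝ g₂]

/-- If `H¹` is spanned by the trace form, an abelian nilradical of codimension one is the kernel of
the trace form: a linear form defining an ideal of codimension one is closed. -/
theorem lie_ker_adTrace_eq_zero (hL : finrank ℝ g₄ = 4) (h1 : h g₄ 1 = 1) (hT0 : adTrace g₄ ≠ 0)
    (hN : IsAbelianOfDim (nilradical g₄) 3) (x y : g₄) (hx : adTrace g₄ x = 0)
    (hy : adTrace g₄ y = 0) : ⁅x, y⁆ = 0 := by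
  have : FiniteDimensional ℝ g₄ := FiniteDimensional.of_finrank_pos (by omega)
  obtain ⟨hab, -, hN3⟩ := hN
  set N : Submodule ℝ g₄ := (nilradical g₄).toSubmodule with hNdef
  have hN3 : finrank ℝ N = 3 := hN3
  have hlt : N < ⊤ := by
    refine lt_of_le_of_ne le_top fun h => ?_
    rw [h, finrank_top] at hN3
    omega
  obtain ⟨φ, hφ0, hφ⟩ := Submodule.exists_le_ker_of_lt_top N hlt
  have hker : N = LinearMap.ker φ := by
    refine Submodule.eq_of_le_of_finrank_eq hφ ?_
    have := Module.Dual.finrank_ker_add_one_of_ne_zero hφ0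
    omega
  have hcl : ∀ x y : g₄, φ ⁅x, y⁆ = 0 := by
    -- modulo `ker φ`, both vectors are multiples of a single one
    obtain ⟨v, hv⟩ : ∃ v, φ v ≠ 0 := by
      by_contra! h'
      exact hφ0 (LinearMap.ext h')
    have hid : ∀ x n : g₄, φ n = 0 → φ ⁅x, n⁆ = 0 := by
      intro x n hn
      have hn' : n ∈ nilradical g₄ := by
        change n ∈ N
        rw [hker]
        exact hn
      have : ⁅x, n⁆ ∈ N := lie_mem_right ℝ g₄ (nilradical g₄) x n hn'
      rw [hker] at this
      exact this
    intro x y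
    have key : ∀ x : g₄, φ (x - (φ x / φ v) • v) = 0 := fun x => by
      simp [div_mul_cancel₀ _ hv]
    have e1 := hid x _ (key y)
    have e2 := hid v _ (key x)
    rw [← lie_skew] at e2
    simp only [lie_sub, lie_smul, sub_lie, smul_lie, lie_self, map_sub, map_smul, map_neg,
      smul_eq_mul, smul_zero, sub_zero, neg_eq_zero] at e1 e2
    rw [e2, mul_zero, sub_zero] at e1
    exact e1
  obtain ⟨r, hr⟩ := exists_smul_of_closed h1 (adTrace g₄) φ hT0 adTrace_lie hcl
  have hmem : ∀ z, adTrace g₄ z = 0 → z ∈ nilradical g₄ := by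
    intro z hz
    change z ∈ N
    rw [hker, LinearMap.mem_ker, hr, LinearMap.smul_apply, hz, smul_zero]
  have := hab.trivial ⟨x, hmem x hx⟩ ⟨y, hmem y hy⟩
  exact congrArg Subtype.val this

/-- The slices are exact and the kernel of the trace form is abelian, so they vanish on it; the
bracket of `g₂` plays no role. -/
theorem quarticInvariant_nonneg_of_nilradical (c : Basis (Fin 2) ℝ g₂)
    (hL : finrank ℝ g₄ = 4) (hN : IsAbelianOfDim (nilradical g₄) 3)
    (h1 : h g₄ 1 = 1) (h2 : h g₄ 2 = 0) (h4 : h g₄ 4 = 0)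
    (ν : (g₄ × g₂) [⋀^Fin 6]→ₗ[ℝ] ℝ) (hν : ν ≠ 0) (ρ : (g₄ × g₂) [⋀^Fin 3]→ₗ[ℝ] ℝ)
    (hρ : d (g₄ × g₂) 3 ρ = 0) : 0 ≤ quarticInvariant ν ρ := by
  have : FiniteDimensional ℝ g₄ := FiniteDimensional.of_finrank_pos (by omega)
  have hT0 := adTrace_ne_zero hL h4
  obtain ⟨b, hb⟩ := exists_basis_coord_last hL (adTrace g₄) hT0
  have hT : ∀ i ≠ 3, adTrace g₄ (b i) = 0 := fun i hi => by rw [← hb]; simp [hi]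
  have hlie : ∀ i ≠ 3, ∀ j ≠ 3, ⁅b i, b j⁆ = 0 := fun i hi j hj =>
    lie_ker_adTrace_eq_zero hL h1 hT0 hN _ _ (hT i hi) (hT j hj)
  have hs : ∀ k, ∀ i ≠ 3, ∀ j ≠ 3, slice ρ (c k) ![b i, b j] = 0 := by
    intro k i hi j hj
    obtain ⟨η, hη⟩ := exists_primitive h2 _ (d_slice ρ hρ (c k))
    rw [hη, hlie i hi j hj, map_zero, neg_zero]
  exact quarticInvariant_nonneg_of_slices b c ν hν ρ (base_eq_zero ρ hρ b hb)
    (hs _ _ (by decide) _ (by decide)) (hs _ _ (by decide) _ (by decide))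
    (hs _ _ (by decide) _ (by decide)) (hs _ _ (by decide) _ (by decide))
    (hs _ _ (by decide) _ (by decide)) (hs _ _ (by decide) _ (by decide))

/-- If the slices of `ρ` are dependent on `ker τ`, one of them may be assumed to vanish there: the
basis of `g₂` is changed by a similarity, which only scales the mixed component. -/
theorem exists_basis_slice_eq_zero (c : Basis (Fin 2) ℝ g₂) (ρ : (g₄ × g₂) [⋀^Fin 3]→ₗ[ℝ] ℝ)
    (τ : Dual ℝ g₄) (hdep : ¬ IndepOnKer τ (toBilin (slice ρ (c 0))) (toBilin (slice ρ (c 1)))) :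
    ∃ (c' : Basis (Fin 2) ℝ g₂) (s : ℝ), s ≠ 0 ∧
      (∀ x y, τ x = 0 → τ y = 0 → slice ρ (c' 0) ![x, y] = 0) ∧
      mixed ρ (c' 0) (c' 1) = s • mixed ρ (c 0) (c 1) := by
  simp only [IndepOnKer, not_forall] at hdep
  obtain ⟨p, q, hz, hpq⟩ := hdep
  have hs : p ^ 2 + q ^ 2 ≠ 0 := by
    intro h'
    exact hpq ⟨by nlinarith [sq_nonneg p, sq_nonneg q], by nlinarith [sq_nonneg p, sq_nonneg q]⟩
  obtain ⟨c', hc'⟩ := exists_basis_of_det_ne_zero c !![p, q; -q, p] (by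
    rw [Matrix.det_fin_two_of]
    convert hs using 1
    ring)
  have h0 : c' 0 = p • c 0 + q • c 1 := by rw [hc', Fin.sum_univ_two]; simp
  have h1 : c' 1 = -q • c 0 + p • c 1 := by rw [hc', Fin.sum_univ_two]; simp
  refine ⟨c', _, hs, fun x y hx hy => ?_, ?_⟩
  · rw [h0, slice_comb]
    exact hz x y hx hy
  · rw [h0, h1, mixed_comb]

/-- If the slices are dependent on `ker τ` and the mixed component is a multiple of `τ`, then
`λ(ρ) ≥ 0`. -/
theorem quarticInvariant_nonneg_of_dependent (c : Basis (Fin 2) ℝ g₂)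
    (hL : finrank ℝ g₄ = 4) (ν : (g₄ × g₂) [⋀^Fin 6]→ₗ[ℝ] ℝ) (hν : ν ≠ 0)
    (ρ : (g₄ × g₂) [⋀^Fin 3]→ₗ[ℝ] ℝ) (τ : Dual ℝ g₄) (hτ0 : τ ≠ 0)
    (hdep : ¬ IndepOnKer τ (toBilin (slice ρ (c 0))) (toBilin (slice ρ (c 1))))
    {r : ℝ} (hr : mixed ρ (c 0) (c 1) = r • τ) : 0 ≤ quarticInvariant ν ρ := by
  obtain ⟨c', s, -, hz, hm⟩ := exists_basis_slice_eq_zero c ρ τ hdep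
  obtain ⟨b, rfl⟩ := exists_basis_coord_last hL τ hτ0
  rw [hr] at hm
  exact quarticInvariant_nonneg_of_slice b c' ν hν ρ (by rw [hm]; simp) (by rw [hm]; simp)
    (by rw [hm]; simp) (hz _ _ (by simp) (by simp)) (hz _ _ (by simp) (by simp))
    (hz _ _ (by simp) (by simp))

/-- If a linear form independent of the trace form is closed, all brackets lie in the plane where
both vanish. This plane is abelian, as the trace form vanishes on it, and `b 3` acts on it with
trace one; hence closed two-forms vanish on it. -/
theorem slice_eq_zero (b : Basis (Fin 4) ℝ g₄) (ρ : (g₄ × g₂) [⋀^Fin 3]→ₗ[ℝ] ℝ)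
    (hρ : d (g₄ × g₂) 3 ρ = 0) (hb : b.coord 3 = adTrace g₄)
    (hb2 : ∀ x y : g₄, b.coord 2 ⁅x, y⁆ = 0) (f : g₂) : slice ρ f ![b 0, b 1] = 0 := by
  have hb3 : ∀ x y : g₄, b.coord 3 ⁅x, y⁆ = 0 := by rw [hb]; exact adTrace_lie
  have form : ∀ x y : g₄, ⁅x, y⁆ = b.coord 0 ⁅x, y⁆ • b 0 + b.coord 1 ⁅x, y⁆ • b 1 := by
    intro x y
    conv_lhs => rw [eq_sum_four b ⁅x, y⁆, hb2, hb3]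
    simp
  have t0 := adTrace_apply b (b 0)
  have t1 := adTrace_apply b (b 1)
  have t3 := adTrace_apply b (b 3)
  rw [hb2, hb3, ← hb] at t0 t1 t3
  simp at t0 t1 t3
  rw [← lie_skew (b 1) (b 0), map_neg, Finsupp.neg_apply, zero_eq_neg] at t1
  have h01 : ⁅b 0, b 1⁆ = 0 := by
    rw [form (b 0) (b 1)]
    simp [← t0, t1]
  have hcl := isClosedForm_toBilin _ (d_slice ρ hρ f) (b 0) (b 1) (b 3)
  have hA := toBilin_isAlt (slice ρ f)
  have hA10 := hA.neg_eq (b 0) (b 1)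
  rw [h01, ← lie_skew (b 1) (b 3), form (b 3) (b 0), form (b 3) (b 1)] at hcl
  simp [hA (b 0), hA (b 1), ← hA10] at hcl
  rw [← toBilin_apply]
  linear_combination hcl + toBilin (slice ρ f) (b 0) (b 1) * t3

/-- In case the slices are dependent on the kernel of the trace form, no assumption on the mixed
component is needed. -/
theorem quarticInvariant_nonneg_of_dependent_on_ker_adTrace [IsLieAbelian g₂]
    (c : Basis (Fin 2) ℝ g₂) (hL : finrank ℝ g₄ = 4) (ν : (g₄ × g₂) [⋀^Fin 6]→ₗ[ℝ] ℝ) (hν : ν ≠ 0)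
    (ρ : (g₄ × g₂) [⋀^Fin 3]→ₗ[ℝ] ℝ) (hρ : d (g₄ × g₂) 3 ρ = 0) (hT0 : adTrace g₄ ≠ 0)
    (hdep : ¬ IndepOnKer (adTrace g₄) (toBilin (slice ρ (c 0))) (toBilin (slice ρ (c 1)))) :
    0 ≤ quarticInvariant ν ρ := by
  by_cases hr : ∃ r : ℝ, mixed ρ (c 0) (c 1) = r • adTrace g₄
  · obtain ⟨r, hr⟩ := hr
    exact quarticInvariant_nonneg_of_dependent c hL ν hν ρ _ hT0 hdep hr
  -- the mixed component is a closed form independent of the trace form; take both as coordinates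
  push Not at hr
  obtain ⟨c', s, -, hz, hm⟩ := exists_basis_slice_eq_zero c ρ _ hdep
  obtain ⟨b, hb2, hb3⟩ := exists_basis_coord hL _ _ hT0 hr
  rw [← hb2] at hm
  rw [← hb3] at hz
  exact quarticInvariant_nonneg_of_coord b c' ν hν ρ (by rw [hm]; simp) (by rw [hm]; simp)
    (by rw [hm]; simp) (hz _ _ (by simp) (by simp)) (hz _ _ (by simp) (by simp))
    (hz _ _ (by simp) (by simp))
    (slice_eq_zero b ρ hρ hb3 (by rw [hb2]; exact mixed_lie ρ hρ _ _) _) (base_eq_zero ρ hρ b hb3)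

/-- The sign for abelian `g₂`. The form `τ` to which `classification` applies is the trace form if
that is nonzero, else the mixed component if that is nonzero, else any closed form. -/
theorem quarticInvariant_nonneg_of_not_exceptional [IsLieAbelian g₂] (c : Basis (Fin 2) ℝ g₂)
    (hL : finrank ℝ g₄ = 4) (hind : Indecomposable g₄)
    (ν : (g₄ × g₂) [⋀^Fin 6]→ₗ[ℝ] ℝ) (hν : ν ≠ 0)
    (ρ : (g₄ × g₂) [⋀^Fin 3]→ₗ[ℝ] ℝ) (hρ : d (g₄ × g₂) 3 ρ = 0)
    (hexc : ¬ (IsA41 g₄ ∨ IsA45 g₄ (-1) 1 ∨ IsA49 g₄ (-1 / 2) ∨ IsA412 g₄)) :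
    0 ≤ quarticInvariant ν ρ := by
  have hdep : ∀ τ : Dual ℝ g₄, τ ≠ 0 → (∀ x y : g₄, τ ⁅x, y⁆ = 0) →
      (∀ x, τ x = 0 → adTrace g₄ x = 0) →
      ¬ IndepOnKer τ (toBilin (slice ρ (c 0))) (toBilin (slice ρ (c 1))) :=
    fun τ hτ0 hτ hT h' => hexc (classification hL hind τ hτ0 hτ hT _ _ (toBilin_isAlt _)
      (isClosedForm_toBilin _ (d_slice ρ hρ _)) (toBilin_isAlt _)
      (isClosedForm_toBilin _ (d_slice ρ hρ _)) h')
  by_cases hT0 : adTrace g₄ = 0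
  · have hT : ∀ x, adTrace g₄ x = 0 := fun x => by rw [hT0, LinearMap.zero_apply]
    by_cases hm : mixed ρ (c 0) (c 1) = 0
    · have : FiniteDimensional ℝ g₄ := FiniteDimensional.of_finrank_pos (by omega)
      obtain ⟨τ, hτ0, hτ⟩ := exists_closed_of_adTrace_eq_zero (finBasisOfFinrankEq ℝ g₄ hL) hT0
      exact quarticInvariant_nonneg_of_dependent c hL ν hν ρ τ hτ0
        (hdep τ hτ0 hτ fun x _ => hT x) (r := 0) (by rw [hm, zero_smul])
    · exact quarticInvariant_nonneg_of_dependent c hL ν hν ρ _ hm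
        (hdep _ hm (mixed_lie ρ hρ _ _) fun x _ => hT x) (one_smul ℝ _).symm
  · exact quarticInvariant_nonneg_of_dependent_on_ker_adTrace c hL ν hν ρ hρ hT0
      (hdep _ hT0 adTrace_lie fun _ h' => h')

end Product

end HalfFlat


theorem proposition4p1 {g₄ g₂ : Type*} [LieRing g₄] [LieAlgebra ℝ g₄] [LieRing g₂] [LieAlgebra ℝ g₂]
    (hdim : Module.finrank ℝ g₄ = 4) (hindec : HalfFlat.Indecomposable g₄)
    (ρ : (g₄ × g₂) [⋀^Fin 3]→ₗ[ℝ] ℝ) (hρ : HalfFlat.d (g₄ × g₂) 3 ρ = 0)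
    (ν : (g₄ × g₂) [⋀^Fin 6]→ₗ[ℝ] ℝ) (hν : ν ≠ 0) :
    (HalfFlat.IsAbelianOfDim g₂ 2 →
      ¬ HalfFlat.IsA41 g₄ → ¬ HalfFlat.IsA45 g₄ (-1) 1 →
      ¬ HalfFlat.IsA49 g₄ (-1 / 2) → ¬ HalfFlat.IsA412 g₄ →
        0 ≤ HalfFlat.quarticInvariant ν ρ) ∧
    (HalfFlat.IsR2 g₂ → HalfFlat.IsAbelianOfDim (HalfFlat.nilradical g₄) 3 →
      HalfFlat.h g₄ 1 = 1 → HalfFlat.h g₄ 2 = 0 → HalfFlat.h g₄ 3 = 0 → HalfFlat.h g₄ 4 = 0 →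
        0 ≤ HalfFlat.quarticInvariant ν ρ) ∧
    (HalfFlat.IsAbelianOfDim g₂ 2 →
      HalfFlat.h g₄ 1 = 1 → HalfFlat.h g₄ 2 = 0 → HalfFlat.h g₄ 3 = 0 → HalfFlat.h g₄ 4 = 0 →
        HalfFlat.quarticInvariant ν ρ = 0) := by
  refine ⟨?_, ?_, ?_⟩
  · rintro ⟨hab, _, hg₂⟩ h41 h45 h49 h412
    exact HalfFlat.quarticInvariant_nonneg_of_not_exceptional (finBasisOfFinrankEq ℝ g₂ hg₂) hdim
      hindec ν hν ρ hρ (by tauto)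
  · rintro ⟨c, -⟩ hN h1 h2 - h4
    exact HalfFlat.quarticInvariant_nonneg_of_nilradical c hdim hN h1 h2 h4 ν hν ρ hρ
  · rintro ⟨hab, _, hg₂⟩ h1 h2 - h4
    exact HalfFlat.quarticInvariant_eq_zero_of_abelian (finBasisOfFinrankEq ℝ g₂ hg₂) hdim h1 h2 h4
      ν hν ρ hρ
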